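/- Let $M$ be a filtered manifold: a smooth (finite-dimensional, Hausdorff, $\sigma$-compact) manifold without boundary, with smooth vector subbundles $0=H^0\subseteq H^1\subseteq\dots\subseteq H^s=TM$ (and $H^i=TM$ for $i>s$) such that $[\Gamma(H^i),\Gamma(H^j)]\subseteq\Gamma(H^{i+j})$ for all $i,j\ge 0$. For $x\in M$ put $\mathfrak g_xM=\mathrm{gr}(T_xM)=\bigoplus_{i\ge1}H^i_x/H^{i-1}_x$. A smooth $k$-form $\omega$ has weight $\ge w$, written $\omega\in\Omega^{k,\ge w}(M)$, if $\omega_x(v_1,\dots,v_k)=0$ whenever $x\in M$, $v_j\in H^{i_j}_x$ and $i_1+\dots+i_k<w$. Let $C^k$ be the space of alternating $\mathbb R$-multilinear maps $\Gamma(TM)^k\to\{\text{functions }M\to\mathbb R\}$, and let $C^{k,\ge w}$ be the subspace of those vanishing on $(V_1,\dots,V_k)$ whenever $V_j\in\Gamma(H^{i_j})$ and $i_1+\dots+i_k<w$. Evaluation on vector fields maps $\Omega^k(M)$ into $C^k$. If a linear map $T$ respects decreasing filtrations $A^{\ge w}$ and $B^{\ge w}$, then $\mathrm{gr}(T)$ denotes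 the induced maps $A^{\ge w}/A^{\ge w+1}\to B^{\ge w}/B^{\ge w+1}$. Let $G\Omega^{k,w}(M)$ be the space of smooth sections of the bundle of alternating $k$-forms on the fibres $\mathfrak g_xM$ which vanish on $k$-tuples of homogeneous elements of total weight $\ne w$. Let $d$ be the exterior derivative. Let $\tilde d$ be its algebraic part, given by $\tilde d=0$ on functions and, for $\omega\in\Omega^k(M)$ with $k\ge1$ and $V_0,\dots,V_k\in\Gamma(TM)$, by $$\tilde d\omega(V_0,\dots,V_k)=\sum_{0\le i<j\le k}(-1)^{i+j}\omega([V_i,V_j],V_0,\dots,\hat V_i,\dots,\hat V_j,\dots,V_k).$$ Since this expression is in general not $C^\infty(M)$-linear in the $V_i$, $\tilde d\omega$ is regarded as an element of $C^{k+1}$. Then the following hold for all $k,w\ge 0$. 1. For each $x$, the commutator of vector fields induces a well-defined alternating bilinear bracket on $\mathfrak g_xM$: the bracket of the classes of $V(x)$ and $W(x)$ is the class of $[V,W](x)$ in $H^{i+j}_x/H^{i+j-1}_x$, for $V\in\Gamma(H^i)$ and $W\in\Gamma(H^j)$. Let $d_{\mathfrak gM}$ be the fibrewise Chevalley–Eilenberg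 differential for this bracket (zero in degree $0$, and given in positive degree by the formula above with the bracket of $\mathfrak g_xM$). 2. There is a canonical linear isomorphism $\Phi:\Omega^{k,\ge w}(M)/\Omega^{k,\ge w+1}(M)\to G\Omega^{k,w}(M)$. It sends the class of $\omega$ to the form whose value at the classes of $v_j\in H^{i_j}_x$ is $\omega_x(v_1,\dots,v_k)$ if $i_1+\dots+i_k=w$, and $0$ otherwise. 3. The maps $d$ and $\tilde d$ respect the filtrations: $d\,\Omega^{k,\ge w}(M)\subseteq\Omega^{k+1,\ge w}(M)$ and $\tilde d\,\Omega^{k,\ge w}(M)\subseteq C^{k+1,\ge w}$. Moreover $(d-\tilde d)\,\Omega^{k,\ge w}(M)\subseteq C^{k+1,\ge w+1}$. 4. The map $\Omega^{k+1,\ge w}(M)/\Omega^{k+1,\ge w+1}(M)\to C^{k+1,\ge w}/C^{k+1,\ge w+1}$ is injective, and under this embedding and the identification $\Phi$ one has $\mathrm{gr}(d)=\mathrm{gr}(\tilde d)=d_{\mathfrak gM}$. 5. Let $X=(X_1,\dots,X_n)$ be a smooth frame of $TM$ over $M$ adapted to the filtration, that is, each $X_a$ carries a weight and, at every point, the $X_a$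 of weight $\le i$ form a basis of $H^i$ for every $i$. Let $\tilde d_X\omega$ be the $(k+1)$-form that takes on the vectors of the frame the values given by the formula for $\tilde d\omega$. Then $\tilde d_X\,\Omega^{k,\ge w}(M)\subseteq\Omega^{k+1,\ge w}(M)$, $(d-\tilde d_X)\,\Omega^{k,\ge w}(M)\subseteq\Omega^{k+1,\ge w+1}(M)$, and $\mathrm{gr}(\tilde d_X)=d_{\mathfrak gM}$ under $\Phi$. -/

import Mathlib

open scoped Manifold ContDiff Bundle

noncomputable section

/-! ### Chevalley-Eilenberg differential with trivial coefficients -/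

section ChevalleyEilenberg

variable {L N : Type*} [AddCommGroup L] [Module ℝ L] [AddCommGroup N] [Module ℝ N]

/-- The Chevalley-Eilenberg expression
`∑_{0 ≤ a < b ≤ k + 1} (-1)^(a + b) α (⁅v_a, v_b⁆, v_0, …, v̂_a, …, v̂_b, …, v_(k+1))`
of a `(k + 1)`-cochain `α`, where `⁅u, v⁆ = B (u, v)`.
The pair `a < b` in `{0, …, k + 1}` is encoded as `a = i.castSucc`, `b = j.succ` with
`i ≤ j` in `{0, …, k}`, so that `a + b = i + (j + 1)`. -/
def ceSum {k : ℕ} (B : L [⋀^Fin 2]→ₗ[ℝ] L) (α : L [⋀^Fin (k + 1)]→ₗ[ℝ] N)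
    (v : Fin (k + 2) → L) : N :=
  ∑ i : Fin (k + 1), ∑ j ∈ Finset.Ici i, (-1 : ℤ) ^ ((i : ℕ) + ((j : ℕ) + 1)) •
    α (Matrix.vecCons (B ![v i.castSucc, v j.succ]) (j.removeNth (i.castSucc.removeNth v)))

theorem update_pair {L' : Type*} (u w z : L') : Function.update ![u, w] 1 z = ![u, z] := by
  ext a
  fin_cases a <;> simp

/-- Auxiliary: the bilinear map `(u, w) ↦ α (⁅u, w⁆, ·)`. -/
def ceAuxBilin {k : ℕ} (B : L [⋀^Fin 2]→ₗ[ℝ] L) (α : L [⋀^Fin (k + 1)]→ₗ[ℝ] N) :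
    L →ₗ[ℝ] L →ₗ[ℝ] L [⋀^Fin k]→ₗ[ℝ] N :=
  LinearMap.mk₂ ℝ (fun u w => α.curryLeft (B ![u, w]))
    (fun u u' w => by
      have h := B.toMultilinearMap.cons_add ![w] u u'
      have h' : B ![u + u', w] = B ![u, w] + B ![u', w] := h
      rw [h', map_add])
    (fun c u w => by
      have h := B.toMultilinearMap.cons_smul ![w] c u
      have h' : B ![c • u, w] = c • B ![u, w] := h
      rw [h', map_smul])
    (fun u w w' => by
      have h' : B ![u, w + w'] = B ![u, w] + B ![u, w'] := by
        rw [← update_pair u w (w + w'), ← update_pair u w w', B.map_update_add, update_pair]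
      rw [h', map_add])
    (fun c u w => by
      have h' : B ![u, c • w] = c • B ![u, w] := by
        rw [← update_pair u w (c • w), B.map_update_smul, update_pair]
      rw [h', map_smul])

/-- Auxiliary: the Chevalley-Eilenberg expression is half of a double alternatization. -/
theorem ceSum_eq {k : ℕ} (B : L [⋀^Fin 2]→ₗ[ℝ] L) (α : L [⋀^Fin (k + 1)]→ₗ[ℝ] N)
    (v : Fin (k + 2) → L) :
    ceSum B α v = ((-(1 / 2 : ℝ)) • AlternatingMap.alternatizeUncurryFin
      (AlternatingMap.alternatizeUncurryFinLM ∘ₗ ceAuxBilin B α)) v := by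
  rw [AlternatingMap.smul_apply,
    AlternatingMap.alternatizeUncurryFin_alternatizeUncurryFinLM_comp_apply, ceSum,
    Finset.smul_sum]
  refine Finset.sum_congr rfl fun i _ => ?_
  rw [Finset.smul_sum]
  refine Finset.sum_congr rfl fun j _ => ?_
  have hB : B ![v j.succ, v i.castSucc] = - B ![v i.castSucc, v j.succ] := by
    have h := B.map_swap ![v i.castSucc, v j.succ] (i := 0) (j := 1) (by decide)
    rw [← h]
    congr 1
    ext a
    fin_cases a <;> simp
  have e : ∀ u w : L, ∀ z : Fin k → L,
      ceAuxBilin B α u w z = α (Matrix.vecCons (B ![u, w]) z) := fun u w z => rfl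
  have e' : ∀ z : Fin k → L, ceAuxBilin B α (v j.succ) (v i.castSucc) z
      = - ceAuxBilin B α (v i.castSucc) (v j.succ) z := by
    intro z
    change α.curryLeft (B ![v j.succ, v i.castSucc]) z
      = - α.curryLeft (B ![v i.castSucc, v j.succ]) z
    rw [hB, map_neg, AlternatingMap.neg_apply]
  rw [e', sub_neg_eq_add, ← two_smul ℝ, smul_comm (-(1 / 2 : ℝ)), smul_smul, e]
  have h2 : (-(1 / 2 : ℝ)) * 2 = -1 := by norm_num
  rw [h2, neg_one_smul, ← add_assoc, pow_succ, mul_neg_one, neg_smul, smul_neg]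

/-- The Chevalley-Eilenberg differential (with trivial coefficients) of `k`-cochains associated
with an alternating bilinear bracket `B`: it vanishes on `0`-cochains, and is given by the usual
alternating sum `ceSum` in positive degree. -/
def ceDiff (B : L [⋀^Fin 2]→ₗ[ℝ] L) :
    {k : ℕ} → (L [⋀^Fin k]→ₗ[ℝ] N) → L [⋀^Fin (k + 1)]→ₗ[ℝ] N
  | 0, _ => 0
  | _ + 1, α =>
    { toFun := ceSum B α
      map_update_add' := by
        intro _ v i x y
        simp only [ceSum_eq]
        exact AlternatingMap.map_update_add _ v i x y
      map_update_smul' := by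
        intro _ v i c x
        simp only [ceSum_eq]
        exact AlternatingMap.map_update_smul _ v i c x
      map_eq_zero_of_eq' := by
        intro v i j hv hij
        simp only [ceSum_eq]
        exact AlternatingMap.map_eq_zero_of_eq _ v hv hij }

end ChevalleyEilenberg

/-! ### Decreasing filtrations and associated graded maps -/

section Graded

variable {A B : Type*} [AddCommGroup A] [Module ℝ A] [AddCommGroup B] [Module ℝ B]

/-- The piece of weight `w` of the graded space associated with a decreasing filtration
`FA 0 ⊇ FA 1 ⊇ …`, namely `FA w / FA (w + 1)`. -/
abbrev GrPiece (FA : ℕ → Submodule ℝ A) (w : ℕ) : Type _ :=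
  ↥(FA w) ⧸ (FA (w + 1)).submoduleOf (FA w)

/-- `T` is linear on the filtered space `FA` and respects the filtrations,
i.e. `T (FA w) ⊆ FB w` for all `w`. -/
structure RespectsFiltration (T : A → B) (FA : ℕ → Submodule ℝ A) (FB : ℕ → Submodule ℝ B) :
    Prop where
  mem : ∀ w, ∀ a ∈ FA w, T a ∈ FB w
  add : ∀ w, ∀ a ∈ FA w, ∀ b ∈ FA w, T (a + b) = T a + T b
  smul : ∀ w (c : ℝ), ∀ a ∈ FA w, T (c • a) = c • T a

/-- The map induced on the graded pieces, `gr T (a mod FA (w + 1)) = T a mod FB (w + 1)`. -/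
def grMap {T : A → B} {FA : ℕ → Submodule ℝ A} {FB : ℕ → Submodule ℝ B}
    (h : RespectsFiltration T FA FB) (w : ℕ) : GrPiece FA w →ₗ[ℝ] GrPiece FB w :=
  Submodule.mapQ _ _
    { toFun := fun a => ⟨T a, h.mem w a a.2⟩
      map_add' := fun a b => Subtype.ext (h.add w a a.2 b b.2)
      map_smul' := fun c a => Subtype.ext (h.smul w c a a.2) }
    (fun a ha => h.mem (w + 1) a ha)

end Graded

/-! ### Vector fields, differential forms, exterior derivative -/

section Forms

variable (E : Type*) [NormedAddCommGroup E] [NormedSpace ℝ E]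
  (M : Type*) [TopologicalSpace M] [ChartedSpace E M]

/-- Tangent space of a manifold modelled on `E`. -/
abbrev TSp {M : Type*} [TopologicalSpace M] [ChartedSpace E M] (x : M) : Type _ :=
  TangentSpace 𝓘(ℝ, E) x

/-- The real vector space `Γ(TM)` of smooth vector fields. -/
abbrev VField [IsManifold 𝓘(ℝ, E) ∞ M] : Type _ :=
  Cₛ^∞⟮𝓘(ℝ, E); E, (TSp E : M → Type _)⟯

/-- Fields of alternating `k`-forms on `M`, without any regularity. -/
abbrev FormField (k : ℕ) : Type _ :=
  (x : M) → TSp E x [⋀^Fin k]→L[ℝ] ℝ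

variable {E M}

/-- Smoothness of a field of alternating forms, as a section of `⋀ᵏ T*M`. -/
def IsSmoothForm [IsManifold 𝓘(ℝ, E) ∞ M] {k : ℕ} (η : FormField E M k) : Prop :=
  ContMDiff 𝓘(ℝ, E) (𝓘(ℝ, E).prod 𝓘(ℝ, E [⋀^Fin k]→L[ℝ] ℝ)) ∞
    (fun x => Bundle.TotalSpace.mk' (E [⋀^Fin k]→L[ℝ] ℝ)
      (E := fun x : M => TSp E x [⋀^Fin k]→L[ℝ] (Bundle.Trivial M ℝ x)) x (η x))

/-- The exterior derivative: at `x`, transport the form to the model space with the preferred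
chart at `x`, differentiate there, and pull the result back. -/
def extD {k : ℕ} (η : FormField E M k) : FormField E M (k + 1) := fun x =>
  (extDeriv (fun y : E => ((η ((extChartAt 𝓘(ℝ, E) x).symm y) :
        TSp E ((extChartAt 𝓘(ℝ, E) x).symm y) [⋀^Fin k]→L[ℝ] ℝ).compContinuousLinearMap
          (mfderiv 𝓘(ℝ, E) 𝓘(ℝ, E) (extChartAt 𝓘(ℝ, E) x).symm y) :
        E [⋀^Fin k]→L[ℝ] ℝ)) (extChartAt 𝓘(ℝ, E) x x)).compContinuousLinearMap
    (mfderiv 𝓘(ℝ, E) 𝓘(ℝ, E) (extChartAt 𝓘(ℝ, E) x) x)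


variable [IsManifold 𝓘(ℝ, E) ∞ M]

/-- The Lie bracket of smooth vector fields, as an alternating `ℝ`-bilinear map on `Γ(TM)`. -/
def vfBracket [FiniteDimensional ℝ E] : VField E M [⋀^Fin 2]→ₗ[ℝ] VField E M where
  toFun V := ⟨VectorField.mlieBracket 𝓘(ℝ, E) (V 0) (V 1), by
    have : CompleteSpace E := FiniteDimensional.complete ℝ E
    have : IsManifold 𝓘(ℝ, E) (((⊤ : ℕ∞) : WithTop ℕ∞) + 1) M := by
      simpa using (inferInstance : IsManifold 𝓘(ℝ, E) ∞ M)
    have : IsManifold 𝓘(ℝ, E) (minSmoothness ℝ 2) M := by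
      simpa using (inferInstance : IsManifold 𝓘(ℝ, E) 2 M)
    exact ContDiff.mlieBracket_vectorField (m := ⊤) (n := ⊤) (V 0).contMDiff (V 1).contMDiff
      (by simp)⟩
  map_update_add' := by
    intro _ V i Y Z
    have : CompleteSpace E := FiniteDimensional.complete ℝ E
    have md : ∀ (Y : VField E M) (x : M), MDifferentiableAt 𝓘(ℝ, E) (𝓘(ℝ, E).prod 𝓘(ℝ, E))
        (fun x => Bundle.TotalSpace.mk' E x (Y x)) x :=
      fun Y x => Y.contMDiff.mdifferentiable (by simp) x
    apply ContMDiffSection.ext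
    intro x
    fin_cases i
    · simpa using VectorField.mlieBracket_add_left (W := V 1) (md Y x) (md Z x)
    · simpa using VectorField.mlieBracket_add_right (V := V 0) (md Y x) (md Z x)
  map_update_smul' := by
    intro _ V i c Y
    have : CompleteSpace E := FiniteDimensional.complete ℝ E
    have md : ∀ (Y : VField E M) (x : M), MDifferentiableAt 𝓘(ℝ, E) (𝓘(ℝ, E).prod 𝓘(ℝ, E))
        (fun x => Bundle.TotalSpace.mk' E x (Y x)) x :=
      fun Y x => Y.contMDiff.mdifferentiable (by simp) x
    apply ContMDiffSection.ext
    intro x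
    fin_cases i
    · simpa using VectorField.mlieBracket_const_smul_left (W := V 1) (c := c) (md Y x)
    · simpa using VectorField.mlieBracket_const_smul_right (V := V 0) (c := c) (md Y x)
  map_eq_zero_of_eq' := by
    intro V i j h hij
    have h01 : V 0 = V 1 := by
      fin_cases i <;> fin_cases j <;> simp_all
    apply ContMDiffSection.ext
    intro x
    simp [h01]

/-- The space `C^k` of alternating `ℝ`-multilinear maps from `k`-tuples of smooth vector fields to
functions on `M` (no `C^∞(M)`-linearity is required). -/
abbrev Cochain (E : Type*) [NormedAddCommGroup E] [NormedSpace ℝ E]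
    (M : Type*) [TopologicalSpace M] [ChartedSpace E M] [IsManifold 𝓘(ℝ, E) ∞ M] (k : ℕ) : Type _ :=
  VField E M [⋀^Fin k]→ₗ[ℝ] (M → ℝ)

/-- A field of `k`-forms viewed as a cochain, `(V_1, …, V_k) ↦ η (V_1, …, V_k)`. -/
def evalForm {k : ℕ} (η : FormField E M k) : Cochain E M k where
  toFun V := fun x => η x (fun j => V j x)
  map_update_add' := by
    intro _ V i Y Z
    funext x
    have e : ∀ Y : VField E M, (fun j => Function.update V i Y j x) =
        Function.update (fun j => V j x) i (Y x) := by
      intro Y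
      funext j
      by_cases hj : j = i
      · subst hj; simp
      · simp [hj]
    simp only [Pi.add_apply, e]
    exact (η x).map_update_add _ i (Y x) (Z x)
  map_update_smul' := by
    intro _ V i c Y
    funext x
    have e : ∀ Y : VField E M, (fun j => Function.update V i Y j x) =
        Function.update (fun j => V j x) i (Y x) := by
      intro Y
      funext j
      by_cases hj : j = i
      · subst hj; simp
      · simp [hj]
    simp only [Pi.smul_apply, e]
    exact (η x).map_update_smul _ i c (Y x)
  map_eq_zero_of_eq' := by
    intro V i j h hij
    funext x
    exact (η x).map_eq_zero_of_eq _ (by rw [h]) hij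

/-- The algebraic part of the exterior derivative:
`(V_0, …, V_k) ↦ ∑_{i < j} (-1)^(i+j) η ([V_i, V_j], V_0, …, V̂_i, …, V̂_j, …, V_k)`
for smooth vector fields `V_0, …, V_k`, and `0` when `k = 0`. -/
def algD [FiniteDimensional ℝ E] {k : ℕ} (η : FormField E M k) : Cochain E M (k + 1) :=
  ceDiff vfBracket (evalForm η)

end Forms

/-! ### Filtered manifolds -/

section Filtered

/-- A family of subspaces of the tangent spaces is a smooth vector subbundle of `TM`: locally it
is spanned by pointwise linearly independent smooth vector fields. -/
def IsSmoothSubbundle {E : Type*} [NormedAddCommGroup E] [NormedSpace ℝ E]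
    {M : Type*} [TopologicalSpace M] [ChartedSpace E M] [IsManifold 𝓘(ℝ, E) ∞ M]
    (K : (x : M) → Submodule ℝ (TSp E x)) : Prop :=
  ∀ x₀ : M, ∃ U : Set M, IsOpen U ∧ x₀ ∈ U ∧ ∃ (r : ℕ) (X : Fin r → (x : M) → TSp E x),
    (∀ a, ContMDiffOn 𝓘(ℝ, E) (𝓘(ℝ, E).prod 𝓘(ℝ, E)) ∞
      (fun x => Bundle.TotalSpace.mk' E x (X a x)) U) ∧
    ∀ x ∈ U, LinearIndependent ℝ (fun a => X a x) ∧
      Submodule.span ℝ (Set.range (fun a => X a x)) = K x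

/-- The structure of a filtered manifold on `M`: a filtration
`0 = H 0 ⊆ H 1 ⊆ … ⊆ H s = TM` by smooth subbundles, with `H i = TM` for `i ≥ s`, such that
`[Γ(H i), Γ(H j)] ⊆ Γ(H (i + j))`. -/
structure FilteredManifold (E : Type*) [NormedAddCommGroup E] [NormedSpace ℝ E]
    (M : Type*) [TopologicalSpace M] [ChartedSpace E M] [IsManifold 𝓘(ℝ, E) ∞ M] where
  H : ℕ → (x : M) → Submodule ℝ (TSp E x)
  s : ℕ
  H_zero : ∀ x, H 0 x = ⊥
  H_mono : ∀ x, Monotone (fun i => H i x)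
  H_top : ∀ i, s ≤ i → ∀ x, H i x = ⊤
  subbundle : ∀ i, IsSmoothSubbundle (H i)
  bracket_mem : ∀ (i j : ℕ) (V W : VField E M), (∀ x, V x ∈ H i x) → (∀ x, W x ∈ H j x) →
    ∀ x, VectorField.mlieBracket 𝓘(ℝ, E) V W x ∈ H (i + j) x

namespace FilteredManifold

variable {E : Type*} [NormedAddCommGroup E] [NormedSpace ℝ E]
  {M : Type*} [TopologicalSpace M] [ChartedSpace E M] [IsManifold 𝓘(ℝ, E) ∞ M]
  (F : FilteredManifold E M)

/-! #### Weights of forms and of cochains -/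

/-- The space `Ω^{k, ≥ w}(M)` of smooth `k`-forms of weight at least `w`. -/
def formGE (k w : ℕ) : Submodule ℝ (FormField E M k) where
  carrier := {η | IsSmoothForm η ∧
    ∀ (x : M) (i : Fin k → ℕ) (v : Fin k → TSp E x),
      (∀ j, v j ∈ F.H (i j) x) → ∑ j, i j < w → η x v = 0}
  zero_mem' := by
    refine ⟨?_, fun _ _ _ _ _ => rfl⟩
    exact Bundle.contMDiff_zeroSection ℝ
      (fun x : M => TSp E x [⋀^Fin k]→L[ℝ] (Bundle.Trivial M ℝ x))
  add_mem' := by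
    intro η θ hη hθ
    refine ⟨ContMDiff.add_section hη.1 hθ.1, fun x i v hv h => ?_⟩
    rw [Pi.add_apply, ContinuousAlternatingMap.add_apply, hη.2 x i v hv h, hθ.2 x i v hv h,
      add_zero]
  smul_mem' := by
    intro c η hη
    refine ⟨ContMDiff.const_smul_section (a := c) hη.1, fun x i v hv h => ?_⟩
    rw [Pi.smul_apply, ContinuousAlternatingMap.smul_apply, hη.2 x i v hv h, smul_zero]

/-- The space of cochains of weight at least `w`: those that vanish on `(V_1, …, V_k)` whenever
`V_j ∈ Γ(H^{i_j})` with `i_1 + … + i_k < w`. -/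
def cochainGE (k w : ℕ) : Submodule ℝ (Cochain E M k) where
  carrier := {c | ∀ (i : Fin k → ℕ) (V : Fin k → VField E M),
    (∀ j x, V j x ∈ F.H (i j) x) → ∑ j, i j < w → c V = 0}
  zero_mem' := by
    intro i V _ _
    rfl
  add_mem' := by
    intro c c' hc hc' i V hV hi
    rw [AlternatingMap.add_apply, hc i V hV hi, hc' i V hV hi, add_zero]
  smul_mem' := by
    intro r c hc i V hV hi
    rw [AlternatingMap.smul_apply, hc i V hV hi, smul_zero]

/-! #### The osculating Lie algebras -/

/-- The graded tangent space `gr (T_x M) = ⨁_i H^i_x / H^{i-1}_x`.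
The summand of index `0` is trivial, and so are those of index `> s`. -/
def Gr (x : M) : Type _ :=
  DirectSum ℕ (fun i => ↥(F.H i x) ⧸ (F.H (i - 1) x).submoduleOf (F.H i x))

instance (x : M) : AddCommGroup (F.Gr x) :=
  inferInstanceAs (AddCommGroup
    (DirectSum ℕ (fun i => ↥(F.H i x) ⧸ (F.H (i - 1) x).submoduleOf (F.H i x))))

instance (x : M) : Module ℝ (F.Gr x) :=
  inferInstanceAs (Module ℝ
    (DirectSum ℕ (fun i => ↥(F.H i x) ⧸ (F.H (i - 1) x).submoduleOf (F.H i x))))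

/-- The class `⟨v⟩` of `v ∈ H^i_x` in the summand `H^i_x / H^{i-1}_x` of `gr (T_x M)`. -/
def cls {x : M} (i : ℕ) (v : TSp E x) (hv : v ∈ F.H i x) : F.Gr x :=
  DirectSum.lof ℝ ℕ (fun i => ↥(F.H i x) ⧸ (F.H (i - 1) x).submoduleOf (F.H i x)) i
    (Submodule.Quotient.mk ⟨v, hv⟩)

/-- The alternating bilinear map `B` on `gr (T_x M)` is the bracket induced by the commutator of
vector fields: `B (⟨V(x)⟩, ⟨W(x)⟩) = ⟨[V, W](x)⟩ ∈ H^{i+j}_x / H^{i+j-1}_x`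
for `V ∈ Γ(H^i)`, `W ∈ Γ(H^j)`. -/
def IsOscBracket (x : M) (B : F.Gr x [⋀^Fin 2]→ₗ[ℝ] F.Gr x) : Prop :=
  ∀ (i j : ℕ) (V W : VField E M) (hV : ∀ y, V y ∈ F.H i y) (hW : ∀ y, W y ∈ F.H j y),
    B ![F.cls i (V x) (hV x), F.cls j (W x) (hW x)] =
      F.cls (i + j) (VectorField.mlieBracket 𝓘(ℝ, E) V W x) (F.bracket_mem i j V W hV hW x)

open Classical in
/-- The Lie bracket of the osculating Lie algebra `𝔤_x M = gr (T_x M)`, i.e. the bracket induced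
by the commutator of vector fields. -/
def oscBracket (x : M) : F.Gr x [⋀^Fin 2]→ₗ[ℝ] F.Gr x :=
  if h : ∃ B, F.IsOscBracket x B then h.choose else 0

/-! #### Osculating forms -/

/-- Fields of alternating `k`-forms on the osculating Lie algebras, without any regularity. -/
abbrev OscField (k : ℕ) : Type _ := (x : M) → F.Gr x [⋀^Fin k]→ₗ[ℝ] ℝ

/-- The space of osculating `k`-forms of weight `w`, i.e. of smooth sections of `⋀^{k,w} 𝔤* M`.
Smoothness: evaluating on classes of smooth sections of the `H^i` gives smooth functions.
Weight `w`: the form vanishes on `k`-tuples of homogeneous elements of total weight `≠ w`. -/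
def oscForm (k w : ℕ) : Submodule ℝ (F.OscField k) where
  carrier := {α |
    (∀ (i : Fin k → ℕ) (V : Fin k → VField E M) (hV : ∀ j y, V j y ∈ F.H (i j) y),
      ContMDiff 𝓘(ℝ, E) 𝓘(ℝ, ℝ) ∞
        (fun x => α x (fun j => F.cls (i j) (V j x) (hV j x)))) ∧
    ∀ (x : M) (i : Fin k → ℕ) (v : Fin k → TSp E x) (hv : ∀ j, v j ∈ F.H (i j) x),
      ∑ j, i j ≠ w → α x (fun j => F.cls (i j) (v j) (hv j)) = 0}
  zero_mem' := ⟨fun _ _ _ => contMDiff_const, fun _ _ _ _ _ => rfl⟩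
  add_mem' := by
    intro α β hα hβ
    refine ⟨fun i V hV => (hα.1 i V hV).add (hβ.1 i V hV), fun x i v hv h => ?_⟩
    rw [Pi.add_apply, AlternatingMap.add_apply, hα.2 x i v hv h, hβ.2 x i v hv h, add_zero]
  smul_mem' := by
    intro c α hα
    refine ⟨fun i V hV => contMDiff_const.mul (hα.1 i V hV), fun x i v hv h => ?_⟩
    rw [Pi.smul_apply, AlternatingMap.smul_apply, hα.2 x i v hv h, smul_zero]

/-- The osculating Chevalley-Eilenberg differential `d_{𝔤M}`, acting fibrewise as the
Chevalley-Eilenberg differential of the Lie algebra `𝔤_x M`. -/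
def oscD {k : ℕ} (α : F.OscField k) : F.OscField (k + 1) :=
  fun x => ceDiff (F.oscBracket x) (α x)

/-- The family `Φ` of maps from the graded pieces `Ω^{k, ≥ w} / Ω^{k, ≥ w + 1}` to the osculating
forms of degree `k` and weight `w` is the canonical one: the class of `η` is sent to the
osculating form given, on classes of vectors `v_j ∈ H^{i_j}_x`, by `η (v_1, …, v_k)` if
`i_1 + … + i_k = w`, and by `0` otherwise. -/
def IsCanonical (Φ : ∀ k w : ℕ, GrPiece (F.formGE k) w ≃ₗ[ℝ] F.oscForm k w) : Prop :=
  ∀ (k w : ℕ) (η : F.formGE k w) (x : M) (i : Fin k → ℕ) (v : Fin k → TSp E x)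
    (hv : ∀ j, v j ∈ F.H (i j) x),
    (Φ k w (Submodule.Quotient.mk η) : F.OscField k) x (fun j => F.cls (i j) (v j) (hv j)) =
      if ∑ j, i j = w then (η : FormField E M k) x v else 0

/-! #### Adapted frames -/

/-- A (global) smooth frame `X_1, …, X_n` of `TM` adapted to the filtration: each `X_a` carries a
weight, and at every point the `X_a` of weight at most `i` form a basis of `H^i`. -/
structure AdaptedFrame (n : ℕ) where
  X : Fin n → VField E M
  wt : Fin n → ℕ
  linearIndependent : ∀ x, LinearIndependent ℝ (fun a => X a x)
  span_eq : ∀ i x, Submodule.span ℝ ((fun a => X a x) '' {a | wt a ≤ i}) = F.H i x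

namespace AdaptedFrame

variable {F} {n : ℕ} (P : F.AdaptedFrame n)

/-- The basis of `T_x M` given by the frame. -/
def basis (x : M) : Module.Basis (Fin n) ℝ (TSp E x) :=
  Module.Basis.mk (P.linearIndependent x) (by
    rw [← F.H_top F.s le_rfl x, ← P.span_eq F.s x]
    exact Submodule.span_mono (Set.image_subset_range _ _))

/-- The alternating bilinear map on `T_x M` with `(X_a(x), X_b(x)) ↦ [X_a, X_b](x)`. -/
def bracket (x : M) : TSp E x [⋀^Fin 2]→ₗ[ℝ] TSp E x where
  toFun v := ∑ a, ∑ b, ((P.basis x).coord a (v 0) * (P.basis x).coord b (v 1)) •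
    VectorField.mlieBracket 𝓘(ℝ, E) (P.X a) (P.X b) x
  map_update_add' := by
    intro _ v i y z
    fin_cases i <;> simp [add_mul, mul_add, add_smul, Finset.sum_add_distrib]
  map_update_smul' := by
    intro _ v i c y
    fin_cases i <;> simp [Finset.smul_sum, smul_smul, mul_assoc, mul_left_comm]
  map_eq_zero_of_eq' := by
    intro v i j h hij
    have h01 : v 0 = v 1 := by
      fin_cases i <;> fin_cases j <;> simp_all
    rw [h01]
    have : IsAddTorsionFree (TSp E x) := IsAddTorsionFree.of_isTorsionFree ℝ _
    apply self_eq_neg.mp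
    conv_lhs => rw [Finset.sum_comm]
    rw [← Finset.sum_neg_distrib]
    refine Finset.sum_congr rfl fun a _ => ?_
    rw [← Finset.sum_neg_distrib]
    refine Finset.sum_congr rfl fun b _ => ?_
    rw [VectorField.mlieBracket_swap_apply, smul_neg, mul_comm]

/-- Alternating maps on the finite-dimensional space `T_x M` are continuous. -/
theorem continuous_alternating (P : F.AdaptedFrame n) {k : ℕ} (x : M) (β : TSp E x [⋀^Fin k]→ₗ[ℝ] ℝ) :
    Continuous β := by
  have : FiniteDimensional ℝ (TSp E x) := Module.Basis.finiteDimensional_of_finite (P.basis x)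
  have : T2Space (TSp E x) := inferInstanceAs (T2Space E)
  have e : ∀ v : Fin k → TSp E x, β v = ∑ r : Fin k → Fin n,
      (∏ j, (P.basis x).coord (r j) (v j)) * β (fun j => P.basis x (r j)) := by
    intro v
    have hv : v = fun j => ∑ a, (P.basis x).coord a (v j) • P.basis x a := by
      funext j
      exact ((P.basis x).sum_repr (v j)).symm
    conv_lhs => rw [hv]
    have h := β.toMultilinearMap.map_sum
      (fun (j : Fin k) (a : Fin n) => (P.basis x).coord a (v j) • P.basis x a)
    refine h.trans (Finset.sum_congr rfl fun r _ => ?_)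
    exact β.toMultilinearMap.map_smul_univ _ _
  have e' : (β : (Fin k → TSp E x) → ℝ) = fun v => ∑ r : Fin k → Fin n,
      (∏ j, (P.basis x).coord (r j) (v j)) * β (fun j => P.basis x (r j)) := funext e
  rw [e']
  refine continuous_finsetSum _ fun r _ => Continuous.mul ?_ continuous_const
  refine continuous_finsetProd _ fun j _ => ?_
  exact (LinearMap.continuous_of_finiteDimensional _).comp (continuous_apply j)

/-- The algebraic part of the exterior derivative computed in the frame: the field of
`(k + 1)`-forms given on the vectors of the frame by
`(X_{a_0}, …, X_{a_k}) ↦ ∑_{i < j} (-1)^(i+j) η ([X_{a_i}, X_{a_j}], X_{a_0}, …, X_{a_k})`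
(with `X_{a_i}`, `X_{a_j}` omitted), and extended `C^∞(M)`-multilinearly. -/
def algD {k : ℕ} (η : FormField E M k) : FormField E M (k + 1) := fun x =>
  { ceDiff (P.bracket x) (η x).toAlternatingMap with
    cont := P.continuous_alternating x _ }

end AdaptedFrame

end FilteredManifold

end Filtered

end

noncomputable section

/-! ### Multilinear algebra -/

section Algebra

variable {L N G : Type*} [AddCommGroup L] [Module ℝ L] [AddCommGroup N] [Module ℝ N]
  [AddCommGroup G] [Module ℝ G]

/-- A multilinear map which vanishes on tuples of elements of the sets `S j` vanishes on tuples of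
elements of their spans. -/
theorem MultilinearMap.eq_zero_of_mem_span {k : ℕ} (f : MultilinearMap ℝ (fun _ : Fin k => L) N)
    (S : Fin k → Set L) (h : ∀ v : Fin k → L, (∀ j, v j ∈ S j) → f v = 0)
    (v : Fin k → L) (hv : ∀ j, v j ∈ Submodule.span ℝ (S j)) : f v = 0 := by
  suffices H : ∀ (t : Finset (Fin k)) (v : Fin k → L), (∀ j ∈ t, v j ∈ Submodule.span ℝ (S j)) →
      (∀ j ∉ t, v j ∈ S j) → f v = 0 from
    H Finset.univ v (fun j _ => hv j) (fun j hj => absurd (Finset.mem_univ j) hj)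
  intro t
  induction t using Finset.induction_on with
  | empty => exact fun v _ hv => h v fun j => hv j (Finset.notMem_empty j)
  | insert a t ha ih =>
    intro v hv hv'
    have key : ∀ y ∈ Submodule.span ℝ (S a), f (Function.update v a y) = 0 := by
      intro y hy
      induction hy using Submodule.span_induction with
      | mem y hy =>
        refine ih _ (fun j hj => ?_) (fun j hj => ?_)
        · have hja : j ≠ a := by rintro rfl; exact ha hj
          rw [Function.update_of_ne hja]
          exact hv j (Finset.mem_insert_of_mem hj)
        · by_cases hja : j = a
          · subst hja
            rwa [Function.update_self]
          · rw [Function.update_of_ne hja]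
            exact hv' j (by simp [hja, hj])
      | zero => exact f.map_update_zero v a
      | add y z _ _ hy hz => rw [f.map_update_add, hy, hz, add_zero]
      | smul c y _ hy => rw [f.map_update_smul, hy, smul_zero]
    simpa using key (v a) (hv a (Finset.mem_insert_self a t))

/-- The sum of the alternating maps `β (i_1 + … + i_k)` precomposed with `T (i_1), …, T (i_k)`,
over all indices `i_1, …, i_k ≤ s`. -/
def gradedSum {k : ℕ} (s : ℕ) (β : ℕ → L [⋀^Fin k]→ₗ[ℝ] N) (T : ℕ → G →ₗ[ℝ] L) :
    G [⋀^Fin k]→ₗ[ℝ] N :=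
  { ∑ i ∈ Fintype.piFinset (fun _ : Fin k => Finset.range (s + 1)),
      (β (∑ j, i j)).toMultilinearMap.compLinearMap (fun j => T (i j)) with
    map_eq_zero_of_eq' := by
      intro u a b hab hne
      have : IsAddTorsionFree N := IsAddTorsionFree.of_isTorsionFree ℝ _
      apply self_eq_neg.mp
      simp only [MultilinearMap.toFun_eq_coe, sum_apply,
        MultilinearMap.compLinearMap_apply, AlternatingMap.coe_multilinearMap]
      rw [← Finset.sum_neg_distrib]
      refine Finset.sum_equiv ((Equiv.swap a b).arrowCongr (Equiv.refl ℕ)) (fun i => ?_)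
        (fun i _ => ?_)
      · simp only [Fintype.mem_piFinset, Equiv.arrowCongr_apply, Equiv.coe_refl, Function.comp_apply,
          id_eq, Equiv.symm_swap]
        exact ⟨fun h j => h _, fun h j => by simpa using h (Equiv.swap a b j)⟩
      · have hs : ∑ j, (Equiv.swap a b).arrowCongr (Equiv.refl ℕ) i j = ∑ j, i j := by
          simpa using Equiv.sum_comp (Equiv.swap a b) i
        rw [hs, eq_neg_iff_add_eq_zero, ← neg_neg (β _ fun j => T _ (u j)), neg_add_eq_zero,
          ← (β _).map_swap _ hne]
        congr 1
        funext j
        simp only [Function.comp_apply, Equiv.arrowCongr_apply, Equiv.coe_refl, id_eq,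
          Equiv.symm_swap]
        congr 1
        rcases eq_or_ne j a with rfl | hja
        · simp [hab]
        · rcases eq_or_ne j b with rfl | hjb
          · simp [hab]
          · rw [Equiv.swap_apply_of_ne_of_ne hja hjb] }

theorem gradedSum_apply {k s : ℕ} (β : ℕ → L [⋀^Fin k]→ₗ[ℝ] N) (T : ℕ → G →ₗ[ℝ] L)
    (u : Fin k → G) (i : Fin k → ℕ) (hu : ∀ j a, a ≠ i j → T a (u j) = 0)
    (hs : ∀ j, s < i j → T (i j) (u j) = 0) :
    gradedSum s β T u = β (∑ j, i j) (fun j => T (i j) (u j)) := by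
  have e : gradedSum s β T u = ∑ i ∈ Fintype.piFinset (fun _ : Fin k => Finset.range (s + 1)),
      β (∑ j, i j) (fun j => T (i j) (u j)) := by
    change (∑ i ∈ Fintype.piFinset (fun _ : Fin k => Finset.range (s + 1)),
      (β (∑ j, i j)).toMultilinearMap.compLinearMap (fun j => T (i j))) u = _
    simp
  rw [e]
  refine Finset.sum_eq_single i (fun i' _ hne => ?_) (fun hi => ?_)
  · obtain ⟨j, hj⟩ := Function.ne_iff.mp hne
    exact (β _).map_coord_zero j (hu j _ hj)
  · simp only [Fintype.mem_piFinset, Finset.mem_range, not_forall, not_lt] at hi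
    obtain ⟨j, hj⟩ := hi
    exact (β _).map_coord_zero j (hs j (by omega))

/-- Every exhaustive flag in a finite-dimensional space has an adapted basis. -/
theorem exists_basis_adapted [FiniteDimensional ℝ L] (H : ℕ → Submodule ℝ L) (hm : Monotone H)
    (h0 : H 0 = ⊥) (s : ℕ) (hs : H s = ⊤) :
    ∃ (n : ℕ) (b : Module.Basis (Fin n) ℝ L) (wt : Fin n → ℕ), (∀ a, b a ∈ H (wt a)) ∧
      ∀ i, Submodule.span ℝ (b '' {a | wt a ≤ i}) = H i := by
  classical
  have key : ∀ m, ∃ B : Set L, LinearIndepOn ℝ id B ∧ B ⊆ H m ∧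
      ∀ i ≤ m, H i ≤ Submodule.span ℝ (B ∩ H i) := by
    intro m
    induction m with
    | zero =>
      refine ⟨∅, linearIndepOn_empty _ _, Set.empty_subset _, fun i hi => ?_⟩
      rw [Nat.le_zero.mp hi, h0]
      exact bot_le
    | succ m ih =>
      obtain ⟨B, hB, hBH, hBs⟩ := ih
      obtain ⟨B', h1, h2, h3, h4⟩ := exists_linearIndepOn_id_extension hB
        (hBH.trans (hm (Nat.le_succ m)))
      refine ⟨B', h4, h1, fun i hi => ?_⟩
      rcases Nat.le_succ_iff.mp hi with h | rfl
      · exact (hBs i h).trans (Submodule.span_mono (Set.inter_subset_inter_left _ h2))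
      · rwa [Set.inter_eq_left.mpr h1]
  obtain ⟨B, hB, -, hBs⟩ := key s
  have hsp : ∀ i, H i ≤ Submodule.span ℝ (B ∩ H i) := by
    intro i
    rcases le_total i s with h | h
    · exact hBs i h
    · have : H i = ⊤ := top_le_iff.mp (hs ▸ hm h)
      have h' := hBs s le_rfl
      rwa [hs, ← this] at h'
  have hfin : B.Finite := hB.setFinite
  have : Fintype B := hfin.fintype
  let e := Fintype.equivFin B
  have hli : LinearIndependent ℝ (fun a : Fin (Fintype.card B) => ((e.symm a : B) : L)) :=
    hB.linearIndependent.comp _ e.symm.injective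
  have hrange : Set.range (fun a : Fin (Fintype.card B) => ((e.symm a : B) : L)) = B := by
    rw [← Function.comp_def, Set.range_comp, e.symm.surjective.range_eq, Set.image_univ,
      Subtype.range_coe]
  have hex : ∀ v : L, ∃ i, v ∈ H i := fun v => ⟨s, by rw [hs]; trivial⟩
  refine ⟨_, Module.Basis.mk hli ?_, fun a => Nat.find (hex (e.symm a : B)), fun a => ?_, fun i => ?_⟩
  · rw [hrange, ← hs]
    exact (hsp s).trans (Submodule.span_mono Set.inter_subset_left)
  · rw [Module.Basis.mk_apply]
    exact Nat.find_spec (hex _)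
  · rw [Module.Basis.coe_mk]
    apply le_antisymm
    · rw [Submodule.span_le]
      rintro _ ⟨a, ha, rfl⟩
      exact hm ha (Nat.find_spec (hex (e.symm a : B)))
    · refine (hsp i).trans (Submodule.span_mono ?_)
      rintro v ⟨hv, hvi⟩
      exact ⟨e ⟨v, hv⟩, by simpa using ⟨i, le_rfl, hvi⟩, by simp⟩

end Algebra


/-! ### Smooth forms and frames -/

section SmoothForms

open scoped Topology

theorem AlternatingMap.apply_sum_smul {L : Type*} [AddCommGroup L] [Module ℝ L] {n k : ℕ}
    (b : Fin n → L) (β : L [⋀^Fin k]→ₗ[ℝ] ℝ) (c : Fin k → Fin n → ℝ) :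
    β (fun j => ∑ a, c j a • b a) = ∑ r : Fin k → Fin n, (∏ j, c j (r j)) * β (fun j => b (r j)) := by
  refine (β.toMultilinearMap.map_sum (fun (j : Fin k) (a : Fin n) => c j a • b a)).trans
    (Finset.sum_congr rfl fun r _ => ?_)
  exact β.toMultilinearMap.map_smul_univ _ _

variable {E : Type*} [NormedAddCommGroup E] [NormedSpace ℝ E]
  {M : Type*} [TopologicalSpace M] [ChartedSpace E M]

section ModelSpace

variable [FiniteDimensional ℝ E] {k : ℕ} {x₀ : M}

/-- A map into a space of continuous alternating forms on a finite-dimensional space is smooth if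
all its values on constant tuples are. -/
theorem contMDiffAt_continuousAlternatingMap_of_apply {g : M → E [⋀^Fin k]→L[ℝ] ℝ}
    (h : ∀ v : Fin k → E, ContMDiffAt 𝓘(ℝ, E) 𝓘(ℝ, ℝ) ∞ (fun x => g x v) x₀) :
    ContMDiffAt 𝓘(ℝ, E) 𝓘(ℝ, E [⋀^Fin k]→L[ℝ] ℝ) ∞ g x₀ := by
  let b := Module.finBasis ℝ E
  let Λ : (E [⋀^Fin k]→L[ℝ] ℝ) →ₗ[ℝ] ((Fin k → Fin (Module.finrank ℝ E)) → ℝ) :=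
    { toFun := fun α r => α (fun j => b (r j))
      map_add' := fun _ _ => rfl
      map_smul' := fun _ _ => rfl }
  have hΛ : LinearMap.ker Λ = ⊥ := by
    rw [LinearMap.ker_eq_bot']
    intro α hα
    apply ContinuousAlternatingMap.toAlternatingMap_injective
    exact Module.Basis.ext_alternating b fun r _ => congrFun hα r
  obtain ⟨R, hR⟩ := Λ.exists_leftInverse_of_injective hΛ
  have e : g = fun x => LinearMap.toContinuousLinearMap R (Λ (g x)) :=
    funext fun x => (LinearMap.congr_fun hR (g x)).symm
  rw [e]
  refine (LinearMap.toContinuousLinearMap R).contDiff.contMDiff.contMDiffAt.comp x₀ ?_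
  rw [contMDiffAt_pi_space]
  exact fun r => h _

theorem ContMDiffAt.continuousAlternatingMap_apply {g : M → E [⋀^Fin k]→L[ℝ] ℝ}
    {v : Fin k → M → E} (hg : ContMDiffAt 𝓘(ℝ, E) 𝓘(ℝ, E [⋀^Fin k]→L[ℝ] ℝ) ∞ g x₀)
    (hv : ∀ j, ContMDiffAt 𝓘(ℝ, E) 𝓘(ℝ, E) ∞ (v j) x₀) :
    ContMDiffAt 𝓘(ℝ, E) 𝓘(ℝ, ℝ) ∞ (fun x => g x (fun j => v j x)) x₀ := by
  let b := Module.finBasis ℝ E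
  have e : (fun x => g x (fun j => v j x)) = fun x =>
      ∑ r : Fin k → Fin (Module.finrank ℝ E), (∏ j, b.coord (r j) (v j x)) *
        g x (fun j => b (r j)) := by
    funext x
    have h := AlternatingMap.apply_sum_smul b (g x).toAlternatingMap (fun j a => b.coord a (v j x))
    refine Eq.trans ?_ h
    rw [ContinuousAlternatingMap.coe_toAlternatingMap]
    congr 1
    funext j
    exact (b.sum_repr (v j x)).symm
  rw [e]
  refine contMDiffAt_finsetSum fun r _ => ContMDiffAt.mul ?_ ?_
  · refine contMDiffAt_finsetProd fun j _ => ?_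
    exact (LinearMap.toContinuousLinearMap (b.coord (r j))).contDiff.contMDiff.contMDiffAt.comp x₀
      (hv j)
  · let ev : (E [⋀^Fin k]→L[ℝ] ℝ) →L[ℝ] ℝ :=
      ContinuousAlternatingMap.apply ℝ E ℝ (fun j => b (r j))
    exact ev.contDiff.contMDiff.contMDiffAt.comp x₀ hg

end ModelSpace

variable [IsManifold 𝓘(ℝ, E) ∞ M]

theorem contMDiffAt_form_iff {k : ℕ} {η : FormField E M k} {x₀ : M} :
    ContMDiffAt 𝓘(ℝ, E) (𝓘(ℝ, E).prod 𝓘(ℝ, E [⋀^Fin k]→L[ℝ] ℝ)) ∞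
      (fun x => Bundle.TotalSpace.mk' (E [⋀^Fin k]→L[ℝ] ℝ)
        (E := fun x : M => TSp E x [⋀^Fin k]→L[ℝ] (Bundle.Trivial M ℝ x)) x (η x)) x₀ ↔
    ContMDiffAt 𝓘(ℝ, E) 𝓘(ℝ, E [⋀^Fin k]→L[ℝ] ℝ) ∞
      (fun x => (η x).compContinuousLinearMap
        ((trivializationAt E (TangentSpace 𝓘(ℝ, E) : M → Type _) x₀).symmL ℝ x)) x₀ := by
  rw [Bundle.contMDiffAt_section]
  refine iff_of_eq (congrArg (fun f => ContMDiffAt _ _ _ f x₀) (funext fun x => ?_))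
  rw [FiberBundle.trivializationAt_continuousAlternatingMap_apply]
  ext v
  simp [ContinuousAlternatingMap.inCoordinates, Function.comp_def]

theorem eventually_mem_baseSet_trivializationAt (x₀ : M) :
    ∀ᶠ x in 𝓝 x₀, x ∈ (trivializationAt E (TangentSpace 𝓘(ℝ, E) : M → Type _) x₀).baseSet :=
  (trivializationAt E (TangentSpace 𝓘(ℝ, E) : M → Type _) x₀).open_baseSet.mem_nhds
    (FiberBundle.mem_baseSet_trivializationAt' x₀)

variable [FiniteDimensional ℝ E] {k n : ℕ} {x₀ : M}

/-- The value of a smooth form on smooth vector fields is smooth. -/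
theorem IsSmoothForm.contMDiffAt_apply {η : FormField E M k} (hη : IsSmoothForm η)
    {V : Fin k → (x : M) → TSp E x}
    (hV : ∀ j, ContMDiffAt 𝓘(ℝ, E) (𝓘(ℝ, E).prod 𝓘(ℝ, E)) ∞
      (fun x => Bundle.TotalSpace.mk' E x (V j x)) x₀) :
    ContMDiffAt 𝓘(ℝ, E) 𝓘(ℝ, ℝ) ∞ (fun x => η x (fun j => V j x)) x₀ := by
  have h := (contMDiffAt_form_iff.mp (hη x₀)).continuousAlternatingMap_apply
    (fun j => (Bundle.contMDiffAt_section x₀).mp (hV j))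
  refine h.congr_of_eventuallyEq ?_
  filter_upwards [eventually_mem_baseSet_trivializationAt (E := E) x₀] with x hx
  rw [ContinuousAlternatingMap.compContinuousLinearMap_apply]
  congr 1
  funext j
  have h := (trivializationAt E (TangentSpace 𝓘(ℝ, E) : M → Type _) x₀).symmL_continuousLinearMapAt
    (R := ℝ) hx (V j x)
  rw [← h]
  congr 1
  rw [Bundle.Trivialization.continuousLinearMapAt_apply,
    Bundle.Trivialization.coe_linearMapAt_of_mem _ hx]

/-- Near a point where smooth vector fields form a basis, smooth vector fields have smooth
coefficients with respect to them. -/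
theorem exists_smooth_coefficients {X : Fin n → (x : M) → TSp E x}
    (hX : ∀ a, ContMDiffAt 𝓘(ℝ, E) (𝓘(ℝ, E).prod 𝓘(ℝ, E)) ∞
      (fun x => Bundle.TotalSpace.mk' E x (X a x)) x₀)
    (b : Module.Basis (Fin n) ℝ (TSp E x₀)) (hb : ∀ a, b a = X a x₀) :
    (∀ᶠ x in 𝓝 x₀, LinearIndependent ℝ (fun a => X a x)) ∧
    ∀ V : (x : M) → TSp E x, ContMDiffAt 𝓘(ℝ, E) (𝓘(ℝ, E).prod 𝓘(ℝ, E)) ∞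
      (fun x => Bundle.TotalSpace.mk' E x (V x)) x₀ →
      ∃ c : Fin n → M → ℝ, (∀ a, ContMDiffAt 𝓘(ℝ, E) 𝓘(ℝ, ℝ) ∞ (c a) x₀) ∧
        ∀ᶠ x in 𝓝 x₀, V x = ∑ a, c a x • X a x := by
  have : CompleteSpace E := FiniteDimensional.complete ℝ E
  let e := trivializationAt E (TangentSpace 𝓘(ℝ, E) : M → Type _) x₀
  have hx₀ : x₀ ∈ e.baseSet := FiberBundle.mem_baseSet_trivializationAt' x₀
  let A : M → (Fin n → ℝ) →L[ℝ] E := fun x =>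
    ∑ a, (ContinuousLinearMap.proj a : (Fin n → ℝ) →L[ℝ] ℝ).smulRight (e ⟨x, X a x⟩).2
  have hAapply : ∀ x c, A x c = ∑ a, c a • (e ⟨x, X a x⟩).2 := by
    intro x c
    simp [A]
  have hA : ContMDiffAt 𝓘(ℝ, E) 𝓘(ℝ, (Fin n → ℝ) →L[ℝ] E) ∞ A x₀ := by
    refine contMDiffAt_finsetSum fun a _ => ?_
    exact (ContinuousLinearMap.smulRightL ℝ (Fin n → ℝ) E
      (ContinuousLinearMap.proj a)).contDiff.contMDiff.contMDiffAt.comp x₀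
        ((Bundle.contMDiffAt_section x₀).mp (hX a))
  have hlin : ∀ x ∈ e.baseSet, ∀ c : Fin n → ℝ,
      e.linearMapAt ℝ x (∑ a, c a • X a x) = A x c := by
    intro x hx c
    rw [hAapply, map_sum]
    refine Finset.sum_congr rfl fun a _ => ?_
    rw [map_smul, e.coe_linearMapAt_of_mem hx]
  let A₀ : (Fin n → ℝ) ≃ₗ[ℝ] E :=
    b.equivFun.symm.trans (e.linearEquivAt ℝ x₀ hx₀)
  have hA₀ : ∀ c, A₀ c = A x₀ c := by
    intro c
    rw [← hlin x₀ hx₀, e.coe_linearMapAt_of_mem hx₀]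
    have h : b.equivFun.symm c = ∑ a, c a • X a x₀ := by
      simp [Module.Basis.equivFun_symm_apply, hb]
    rw [← h]
    rfl
  have hinv : A x₀ = (A₀.toContinuousLinearEquiv : (Fin n → ℝ) →L[ℝ] E) := by
    ext c
    simp [← hA₀]
  have hev : ∀ᶠ x in 𝓝 x₀, (A x).IsInvertible ∧ x ∈ e.baseSet := by
    refine Filter.Eventually.and ?_ (eventually_mem_baseSet_trivializationAt x₀)
    have h : ∀ᶠ B in 𝓝 (A x₀), B.IsInvertible := by
      rw [hinv]
      exact ContinuousLinearEquiv.nhds _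
    exact hA.continuousAt.eventually h
  refine ⟨?_, fun V hV => ?_⟩
  · filter_upwards [hev] with x hx
    rw [Fintype.linearIndependent_iff]
    intro c hc
    have h0 : A x c = 0 := by rw [← hlin x hx.2, hc, map_zero]
    obtain ⟨B, hB⟩ := hx.1
    rw [← hB] at h0
    exact congrFun (B.map_eq_zero_iff.mp h0)
  · have hc : ContMDiffAt 𝓘(ℝ, E) 𝓘(ℝ, Fin n → ℝ) ∞
        (fun x => (A x).inverse (e ⟨x, V x⟩).2) x₀ := by
      refine ContMDiffAt.clm_apply ?_ ((Bundle.contMDiffAt_section x₀).mp hV)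
      refine ContDiffAt.comp_contMDiffAt (g := ContinuousLinearMap.inverse) ?_ hA
      rw [hinv]
      exact contDiffAt_map_inverse _
    refine ⟨fun a x => (A x).inverse (e ⟨x, V x⟩).2 a, contMDiffAt_pi_space.mp hc, ?_⟩
    filter_upwards [hev] with x hx
    obtain ⟨B, hB⟩ := hx.1
    apply (e.linearEquivAt ℝ x hx.2).injective
    have h := hlin x hx.2 ((A x).inverse (e ⟨x, V x⟩).2)
    rw [e.coe_linearMapAt_of_mem hx.2, ← hB, ContinuousLinearMap.inverse_equiv] at h
    simp only [ContinuousLinearEquiv.coe_coe, ContinuousLinearEquiv.apply_symm_apply] at h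
    simp only [← hB, ContinuousLinearMap.inverse_equiv, ContinuousLinearEquiv.coe_coe]
    exact h.symm

/-- A field of forms is smooth at a point if its values on the vector fields of a smooth local
frame are. -/
theorem contMDiffAt_form_of_frame {η : FormField E M k} {X : Fin n → (x : M) → TSp E x}
    (hX : ∀ a, ContMDiffAt 𝓘(ℝ, E) (𝓘(ℝ, E).prod 𝓘(ℝ, E)) ∞
      (fun x => Bundle.TotalSpace.mk' E x (X a x)) x₀)
    (b : Module.Basis (Fin n) ℝ (TSp E x₀)) (hb : ∀ a, b a = X a x₀)
    (hη : ∀ r : Fin k → Fin n,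
      ContMDiffAt 𝓘(ℝ, E) 𝓘(ℝ, ℝ) ∞ (fun x => η x (fun j => X (r j) x)) x₀) :
    ContMDiffAt 𝓘(ℝ, E) (𝓘(ℝ, E).prod 𝓘(ℝ, E [⋀^Fin k]→L[ℝ] ℝ)) ∞
      (fun x => Bundle.TotalSpace.mk' (E [⋀^Fin k]→L[ℝ] ℝ)
        (E := fun x : M => TSp E x [⋀^Fin k]→L[ℝ] (Bundle.Trivial M ℝ x)) x (η x)) x₀ := by
  rw [contMDiffAt_form_iff]
  let e := trivializationAt E (TangentSpace 𝓘(ℝ, E) : M → Type _) x₀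
  have hc := (exists_smooth_coefficients hX b hb).2
  refine contMDiffAt_continuousAlternatingMap_of_apply fun v => ?_
  have hV : ∀ j, ContMDiffAt 𝓘(ℝ, E) (𝓘(ℝ, E).prod 𝓘(ℝ, E)) ∞
      (fun x => Bundle.TotalSpace.mk' E x (e.symmL ℝ x (v j) : TSp E x)) x₀ := by
    intro j
    rw [Bundle.contMDiffAt_section]
    refine (contMDiffAt_const (c := v j)).congr_of_eventuallyEq ?_
    filter_upwards [eventually_mem_baseSet_trivializationAt (E := E) x₀] with x hx
    have h := e.continuousLinearMapAt_symmL (R := ℝ) hx (v j)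
    rwa [Bundle.Trivialization.continuousLinearMapAt_apply,
      Bundle.Trivialization.coe_linearMapAt_of_mem _ hx] at h
  choose c hc hce using fun j => hc _ (hV j)
  have hs : ContMDiffAt 𝓘(ℝ, E) 𝓘(ℝ, ℝ) ∞ (fun x => ∑ r : Fin k → Fin n,
      (∏ j, c j (r j) x) * η x (fun j => X (r j) x)) x₀ :=
    contMDiffAt_finsetSum fun r _ => (contMDiffAt_finsetProd fun j _ => hc j (r j)).mul (hη r)
  refine hs.congr_of_eventuallyEq ?_
  filter_upwards [Filter.eventually_all.mpr hce] with x hx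
  have h := AlternatingMap.apply_sum_smul (fun a => X a x) (η x).toAlternatingMap
    (fun j a => c j a x)
  refine Eq.trans ?_ h
  rw [ContinuousAlternatingMap.compContinuousLinearMap_apply,
    ContinuousAlternatingMap.coe_toAlternatingMap]
  exact congrArg _ (funext hx)

end SmoothForms

/-! ### The exterior derivative -/

section ExteriorDerivative

open scoped Topology

variable {E : Type*} [NormedAddCommGroup E] [NormedSpace ℝ E]
  {M : Type*} [TopologicalSpace M] [ChartedSpace E M]

/-- The derivative at `z` of the preferred chart at `x`. -/
def chartDeriv (x z : M) : TSp E z →L[ℝ] E :=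
  mfderiv 𝓘(ℝ, E) 𝓘(ℝ, E) (extChartAt 𝓘(ℝ, E) x) z

/-- The derivative of the inverse of the preferred chart at `x`. -/
def chartSymmDeriv (x : M) (y : E) : E →L[ℝ] TSp E ((extChartAt 𝓘(ℝ, E) x).symm y) :=
  mfderiv 𝓘(ℝ, E) 𝓘(ℝ, E) (extChartAt 𝓘(ℝ, E) x).symm y

/-- The form `η` read in the preferred chart at `x`. -/
def formInChart {k : ℕ} (η : FormField E M k) (x : M) (y : E) : E [⋀^Fin k]→L[ℝ] ℝ :=
  (η ((extChartAt 𝓘(ℝ, E) x).symm y)).compContinuousLinearMap (chartSymmDeriv x y)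

/-- The vector field `V` read in the preferred chart at `x`. -/
def fieldInChart (V : (x : M) → TSp E x) (x : M) (y : E) : E :=
  (chartSymmDeriv x y).inverse (V ((extChartAt 𝓘(ℝ, E) x).symm y))

theorem extD_apply {k : ℕ} (η : FormField E M k) (x : M) (v : Fin (k + 1) → TSp E x) :
    extD η x v = extDeriv (formInChart η x) (extChartAt 𝓘(ℝ, E) x x)
      (fun j => chartDeriv x x (v j)) := rfl

theorem extD_smul {k : ℕ} (c : ℝ) (η : FormField E M k) : extD (c • η) = c • extD η := by
  funext x
  ext v
  have h := extDeriv_smul c (formInChart η x) (x := extChartAt 𝓘(ℝ, E) x x)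
  exact congrArg (fun α : E [⋀^Fin (k + 1)]→L[ℝ] ℝ => α fun j => chartDeriv x x (v j)) h

variable [IsManifold 𝓘(ℝ, E) ∞ M]

theorem symmL_eq_chartSymmDeriv {x : M} {y : E}
    (hy : y ∈ (extChartAt 𝓘(ℝ, E) x).target) :
    (trivializationAt E (TangentSpace 𝓘(ℝ, E) : M → Type _) x).symmL ℝ
      ((extChartAt 𝓘(ℝ, E) x).symm y) = chartSymmDeriv x y := by
  have h := (extChartAt 𝓘(ℝ, E) x).map_target hy
  rw [extChartAt_source] at h
  rw [TangentBundle.symmL_trivializationAt h, (extChartAt 𝓘(ℝ, E) x).right_inv hy,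
    ModelWithCorners.range_eq_univ, mfderivWithin_univ]
  rfl

theorem isInvertible_chartSymmDeriv {x : M} {y : E} (hy : y ∈ (extChartAt 𝓘(ℝ, E) x).target) :
    (chartSymmDeriv x y).IsInvertible := by
  have h := isInvertible_mfderivWithin_extChartAt_symm (I := 𝓘(ℝ, E)) hy
  rw [ModelWithCorners.range_eq_univ, mfderivWithin_univ] at h
  exact h

theorem chartSymmDeriv_chartDeriv {x : M} {y : E} (hy : y ∈ (extChartAt 𝓘(ℝ, E) x).target)
    (v : TSp E ((extChartAt 𝓘(ℝ, E) x).symm y)) :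
    chartSymmDeriv x y (chartDeriv x _ v) = v := by
  have h := mfderivWithin_extChartAt_symm_comp_mfderiv_extChartAt (I := 𝓘(ℝ, E)) hy
  rw [ModelWithCorners.range_eq_univ, mfderivWithin_univ] at h
  exact DFunLike.congr_fun h v

theorem chartSymmDeriv_fieldInChart (V : (x : M) → TSp E x) {x : M} {y : E}
    (hy : y ∈ (extChartAt 𝓘(ℝ, E) x).target) :
    chartSymmDeriv x y (fieldInChart V x y) = V ((extChartAt 𝓘(ℝ, E) x).symm y) :=
  (isInvertible_chartSymmDeriv hy).self_apply_inverse _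

theorem chartDeriv_eq_fieldInChart (V : (x : M) → TSp E x) (x : M) :
    chartDeriv x x (V x) = fieldInChart V x (extChartAt 𝓘(ℝ, E) x x) := by
  have hy := mem_extChartAt_target (I := 𝓘(ℝ, E)) x
  have e := congrArg (fun z => chartDeriv x z (V z)) (extChartAt_to_inv (I := 𝓘(ℝ, E)) x).symm
  refine e.trans ?_
  rw [fieldInChart]
  conv_rhs => rw [← chartSymmDeriv_chartDeriv hy (V _)]
  exact ((isInvertible_chartSymmDeriv hy).inverse_apply_self _).symm

theorem formInChart_fieldInChart {k : ℕ} (η : FormField E M k) (V : Fin k → (x : M) → TSp E x)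
    {x : M} {y : E} (hy : y ∈ (extChartAt 𝓘(ℝ, E) x).target) :
    formInChart η x y (fun j => fieldInChart (V j) x y) =
      η ((extChartAt 𝓘(ℝ, E) x).symm y) (fun j => V j ((extChartAt 𝓘(ℝ, E) x).symm y)) := by
  rw [formInChart, ContinuousAlternatingMap.compContinuousLinearMap_apply]
  exact congrArg _ (funext fun j => chartSymmDeriv_fieldInChart (V j) hy)

theorem differentiableAt_fieldInChart [CompleteSpace E] {V : (x : M) → TSp E x} {x : M}
    (hV : MDifferentiableAt 𝓘(ℝ, E) (𝓘(ℝ, E).prod 𝓘(ℝ, E))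
      (fun x => Bundle.TotalSpace.mk' E x (V x)) x) :
    DifferentiableAt ℝ (fieldInChart V x) (extChartAt 𝓘(ℝ, E) x x) := by
  have h := (mdifferentiableWithinAt_univ.mpr
    hV).differentiableWithinAt_mpullbackWithin_vectorField
  simp only [Set.preimage_univ, Set.univ_inter, ModelWithCorners.range_eq_univ,
    VectorField.mpullbackWithin_univ] at h
  exact differentiableWithinAt_univ.mp h

/-- The bracket of vector fields read in a chart is the bracket of the vector fields read in the
chart. -/
theorem chartDeriv_mlieBracket (V W : (x : M) → TSp E x) (x : M) :
    chartDeriv x x (VectorField.mlieBracket 𝓘(ℝ, E) V W x) =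
      VectorField.lieBracket ℝ (fieldInChart V x) (fieldInChart W x) (extChartAt 𝓘(ℝ, E) x x) := by
  have h := isInvertible_mfderiv_extChartAt (I := 𝓘(ℝ, E)) (mem_extChartAt_source (I := 𝓘(ℝ, E)) x)
  have e : VectorField.mlieBracket 𝓘(ℝ, E) V W x = (chartDeriv x x).inverse
      (VectorField.lieBracket ℝ (fieldInChart V x) (fieldInChart W x)
        (extChartAt 𝓘(ℝ, E) x x)) := by
    rw [← VectorField.mlieBracketWithin_univ, VectorField.mlieBracketWithin_apply]
    simp only [Set.preimage_univ, Set.univ_inter, ModelWithCorners.range_eq_univ,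
      VectorField.mpullbackWithin_univ]
    rw [← VectorField.lieBracketWithin_univ]
    rfl
  rw [e]
  exact h.self_apply_inverse _

theorem IsSmoothForm.contDiffAt_formInChart {k : ℕ} {η : FormField E M k}
    (hη : IsSmoothForm η) (x : M) :
    ContDiffAt ℝ ∞ (formInChart η x) (extChartAt 𝓘(ℝ, E) x x) := by
  have h := contMDiffAt_form_iff.mp (hη x)
  have hs : ContMDiffAt 𝓘(ℝ, E) 𝓘(ℝ, E) ∞ (extChartAt 𝓘(ℝ, E) x).symm (extChartAt 𝓘(ℝ, E) x x) :=
    (contMDiffOn_extChartAt_symm x).contMDiffAt (extChartAt_target_mem_nhds x)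
  rw [← extChartAt_to_inv (I := 𝓘(ℝ, E)) x] at h
  have h' := (h.comp _ hs).contDiffAt
  refine h'.congr_of_eventuallyEq ?_
  filter_upwards [extChartAt_target_mem_nhds (I := 𝓘(ℝ, E)) x] with y hy
  have e := symmL_eq_chartSymmDeriv hy
  simp only [Function.comp_apply, extChartAt_to_inv, e]
  rfl

theorem IsSmoothForm.extD_add {k : ℕ} {η θ : FormField E M k} (hη : IsSmoothForm η)
    (hθ : IsSmoothForm θ) : extD (η + θ) = extD η + extD θ := by
  funext x
  ext v
  have h := extDeriv_add ((hη.contDiffAt_formInChart x).differentiableAt (by simp))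
    ((hθ.contDiffAt_formInChart x).differentiableAt (by simp))
  exact congrArg (fun α : E [⋀^Fin (k + 1)]→L[ℝ] ℝ => α fun j => chartDeriv x x (v j)) h

theorem VField.mdifferentiableAt (V : VField E M) (x : M) :
    MDifferentiableAt 𝓘(ℝ, E) (𝓘(ℝ, E).prod 𝓘(ℝ, E))
      (fun x => Bundle.TotalSpace.mk' E x (V x)) x :=
  V.contMDiff.mdifferentiable (by simp) x

theorem fderiv_comp_extChartAt_symm {f : M → ℝ} {x : M}
    (hf : MDifferentiableAt 𝓘(ℝ, E) 𝓘(ℝ, ℝ) f x) (V : (x : M) → TSp E x) :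
    fderiv ℝ (fun y => f ((extChartAt 𝓘(ℝ, E) x).symm y)) (extChartAt 𝓘(ℝ, E) x x)
      (fieldInChart V x (extChartAt 𝓘(ℝ, E) x x)) = mvfderiv 𝓘(ℝ, E) f x (V x) := by
  have hy := mem_extChartAt_target (I := 𝓘(ℝ, E)) x
  have hs : MDifferentiableAt 𝓘(ℝ, E) 𝓘(ℝ, E) (extChartAt 𝓘(ℝ, E) x).symm
      (extChartAt 𝓘(ℝ, E) x x) :=
    ((contMDiffOn_extChartAt_symm (n := ∞) x).contMDiffAt
      (extChartAt_target_mem_nhds x)).mdifferentiableAt (by simp)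
  have hf' : MDifferentiableAt 𝓘(ℝ, E) 𝓘(ℝ, ℝ) f
      ((extChartAt 𝓘(ℝ, E) x).symm (extChartAt 𝓘(ℝ, E) x x)) := by
    rwa [extChartAt_to_inv]
  have h := mfderiv_comp _ hf' hs
  rw [mfderiv_eq_fderiv] at h
  have e := congrArg (fun z => mvfderiv 𝓘(ℝ, E) f z (V z))
    (extChartAt_to_inv (I := 𝓘(ℝ, E)) x).symm
  refine Eq.trans ?_ e.symm
  have e' := chartSymmDeriv_fieldInChart V hy
  rw [← e']
  exact DFunLike.congr_fun h _

variable [FiniteDimensional ℝ E]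

/-- Cartan's formula: the exterior derivative is the sum of its algebraic part and of the
derivatives of the values of the form. -/
theorem IsSmoothForm.evalForm_extD {k : ℕ} {η : FormField E M k} (hη : IsSmoothForm η)
    (V : Fin (k + 1) → VField E M) (x : M) :
    evalForm (extD η) V x = ∑ i : Fin (k + 1), (-1 : ℤ) ^ (i : ℕ) •
        mvfderiv 𝓘(ℝ, E) (evalForm η (i.removeNth V)) x (V i x) + algD η V x := by
  have : CompleteSpace E := FiniteDimensional.complete ℝ E
  have hy := mem_extChartAt_target (I := 𝓘(ℝ, E)) x
  have hω := (hη.contDiffAt_formInChart x).differentiableAt (by simp)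
  have hV := fun i => differentiableAt_fieldInChart ((V i).mdifferentiableAt x)
  have hL : evalForm (extD η) V x = extDeriv (formInChart η x) (extChartAt 𝓘(ℝ, E) x x)
      (fun j => fieldInChart (V j) x (extChartAt 𝓘(ℝ, E) x x)) := by
    refine (extD_apply η x _).trans (congrArg _ (funext fun j => ?_))
    exact chartDeriv_eq_fieldInChart (V j) x
  have h1 : ∀ i : Fin (k + 1), fderiv ℝ (fun y => formInChart η x y
        (i.removeNth fun j => fieldInChart (V j) x y)) (extChartAt 𝓘(ℝ, E) x x)
        (fieldInChart (V i) x (extChartAt 𝓘(ℝ, E) x x)) =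
      mvfderiv 𝓘(ℝ, E) (evalForm η (i.removeNth V)) x (V i x) := by
    intro i
    have hf : MDifferentiableAt 𝓘(ℝ, E) 𝓘(ℝ, ℝ) (evalForm η (i.removeNth V)) x :=
      (hη.contMDiffAt_apply fun j => (V (i.succAbove j)).contMDiff x).mdifferentiableAt (by simp)
    rw [← fderiv_comp_extChartAt_symm hf]
    have e : (fun y => formInChart η x y (i.removeNth fun j => fieldInChart (V j) x y))
        =ᶠ[𝓝 (extChartAt 𝓘(ℝ, E) x x)]
        fun y => evalForm η (i.removeNth V) ((extChartAt 𝓘(ℝ, E) x).symm y) := by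
      filter_upwards [extChartAt_target_mem_nhds (I := 𝓘(ℝ, E)) x] with y hy
      exact formInChart_fieldInChart η (fun j => V (i.succAbove j)) hy
    rw [e.fderiv_eq]
  rw [hL]
  cases k with
  | zero =>
    rw [extDeriv_apply_vectorField_of_pairwise_commute hω hV
      (fun i j hij => absurd ((Fin.eq_zero i).trans (Fin.eq_zero j).symm) hij)]
    simp only [h1]
    exact (add_zero _).symm
  | succ k =>
    rw [extDeriv_apply_vectorField hω hV, sub_eq_add_neg]
    simp only [h1]
    congr 1
    change _ = ceSum vfBracket (evalForm η) V x
    rw [ceSum, Finset.sum_apply, ← Finset.sum_neg_distrib]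
    refine Finset.sum_congr rfl fun i _ => ?_
    rw [Finset.sum_apply, ← Finset.sum_neg_distrib]
    refine Finset.sum_congr rfl fun j _ => ?_
    rw [← add_assoc, pow_succ, mul_neg_one, neg_smul]
    refine congrArg (fun r : ℝ => -((-1 : ℤ) ^ ((i : ℕ) + (j : ℕ)) • r)) ?_
    let U : Fin (k + 1) → VField E M := Matrix.vecCons (vfBracket ![V i.castSucc, V j.succ])
      (j.removeNth (i.castSucc.removeNth V))
    have e := congrArg (evalForm η U) (extChartAt_to_inv (I := 𝓘(ℝ, E)) x)
    refine Eq.trans ?_ e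
    refine Eq.trans ?_ (formInChart_fieldInChart η (fun l => U l) hy)
    refine congrArg _ (funext fun l => ?_)
    refine Fin.cases ?_ (fun l => rfl) l
    refine (chartDeriv_mlieBracket _ _ x).symm.trans ?_
    exact chartDeriv_eq_fieldInChart (U 0) x

end ExteriorDerivative

/-! ### Smoothness of the exterior derivative -/

section SmoothExteriorDerivative

open scoped Topology

variable {E : Type*} [NormedAddCommGroup E] [NormedSpace ℝ E]
  {M : Type*} [TopologicalSpace M] [ChartedSpace E M] [IsManifold 𝓘(ℝ, E) ∞ M]

/-- Evaluation of vector fields at a point. -/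
def VField.eval (x : M) : VField E M →ₗ[ℝ] TSp E x where
  toFun V := V x
  map_add' _ _ := rfl
  map_smul' _ _ := rfl

theorem contMDiff_mvfderiv_apply {f : M → ℝ} (hf : ContMDiff 𝓘(ℝ, E) 𝓘(ℝ, ℝ) ∞ f)
    (V : VField E M) : ContMDiff 𝓘(ℝ, E) 𝓘(ℝ, ℝ) ∞ (fun x => mvfderiv 𝓘(ℝ, E) f x (V x)) := by
  have h := (hf.contMDiff_tangentMap (m := ∞) (by simp)).comp V.contMDiff
  exact (contMDiff_snd_tangentBundle_modelSpace ℝ 𝓘(ℝ, ℝ)).comp h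

instance (x : M) [FiniteDimensional ℝ E] : FiniteDimensional ℝ (TSp E x) :=
  inferInstanceAs (FiniteDimensional ℝ E)

variable [FiniteDimensional ℝ E]

/-- Cutting off a local smooth vector field. -/
theorem exists_vfield_eq_smul [T2Space M] {U : Set M} (hU : IsOpen U) {x₀ : M} (hx₀ : x₀ ∈ U) :
    ∃ ψ : M → ℝ, (∀ᶠ y in 𝓝 x₀, ψ y = 1) ∧ (∀ y ∉ U, ψ y = 0) ∧
      ∀ X : (x : M) → TSp E x, ContMDiffOn 𝓘(ℝ, E) (𝓘(ℝ, E).prod 𝓘(ℝ, E)) ∞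
        (fun x => Bundle.TotalSpace.mk' E x (X x)) U →
        ∃ V : VField E M, ∀ y, V y = ψ y • X y := by
  obtain ⟨ψ, -, hψ⟩ := (SmoothBumpFunction.nhds_basis_tsupport (I := 𝓘(ℝ, E)) x₀).mem_iff.mp
    (hU.mem_nhds hx₀)
  refine ⟨ψ, ψ.eventuallyEq_one, fun y hy => ?_, fun X hX => ?_⟩
  · exact image_eq_zero_of_notMem_tsupport fun h => hy (hψ h)
  · exact ⟨⟨_, ContMDiffOn.smul_section_of_tsupport ψ.contMDiff.contMDiffOn hU hψ hX⟩, fun y => rfl⟩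

/-- Every tangent vector extends to a smooth vector field. -/
theorem exists_vfield_apply_eq [T2Space M] {x₀ : M} (v : TSp E x₀) :
    ∃ V : VField E M, V x₀ = v := by
  obtain ⟨s, hs, hX⟩ := FiberBundle.exists_contMDiffOn_extend (k := ∞) 𝓘(ℝ, E) E v
  obtain ⟨U, hUs, hU, hx₀⟩ := mem_nhds_iff.mp hs
  obtain ⟨ψ, h1, -, h⟩ := exists_vfield_eq_smul (E := E) hU hx₀
  obtain ⟨V, hV⟩ := h _ (hX.mono hUs)
  refine ⟨V, ?_⟩
  rw [hV, h1.self_of_nhds, one_smul]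
  simp

theorem IsSmoothForm.contMDiff_evalForm {k : ℕ} {η : FormField E M k} (hη : IsSmoothForm η)
    (V : Fin k → VField E M) : ContMDiff 𝓘(ℝ, E) 𝓘(ℝ, ℝ) ∞ (evalForm η V) :=
  fun x => hη.contMDiffAt_apply fun j => (V j).contMDiff x

theorem IsSmoothForm.contMDiff_algD {k : ℕ} {η : FormField E M k} (hη : IsSmoothForm η)
    (V : Fin (k + 1) → VField E M) : ContMDiff 𝓘(ℝ, E) 𝓘(ℝ, ℝ) ∞ (algD η V) := by
  cases k with
  | zero => exact contMDiff_const
  | succ k =>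
    have e : algD η V = fun x => ∑ i : Fin (k + 1), ∑ j ∈ Finset.Ici i,
        (-1 : ℤ) ^ ((i : ℕ) + ((j : ℕ) + 1)) • evalForm η
          (Matrix.vecCons (vfBracket ![V i.castSucc, V j.succ])
            (j.removeNth (i.castSucc.removeNth V))) x := by
      funext x
      change ceSum vfBracket (evalForm η) V x = _
      simp [ceSum]
    rw [e]
    refine contMDiff_finsetSum fun i _ => contMDiff_finsetSum fun j _ => ?_
    simp only [zsmul_eq_mul]
    exact contMDiff_const.mul (hη.contMDiff_evalForm _)

/-- The exterior derivative of a smooth form is smooth. -/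
theorem IsSmoothForm.extD [T2Space M] {k : ℕ} {η : FormField E M k} (hη : IsSmoothForm η) :
    IsSmoothForm (extD η) := by
  intro x₀
  let b := Module.finBasis ℝ (TSp E x₀)
  choose V hV using fun a => exists_vfield_apply_eq (b a)
  refine contMDiffAt_form_of_frame (fun a => (V a).contMDiff x₀) b (fun a => (hV a).symm)
    fun r => ?_
  have e : (fun x => _root_.extD η x fun j => V (r j) x) = fun x =>
      ∑ i : Fin (k + 1), (-1 : ℤ) ^ (i : ℕ) • mvfderiv 𝓘(ℝ, E)
        (evalForm η (i.removeNth fun j => V (r j))) x (V (r i) x) +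
        algD η (fun j => V (r j)) x :=
    funext fun x => hη.evalForm_extD (fun j => V (r j)) x
  rw [e]
  refine ContMDiffAt.add (contMDiffAt_finsetSum fun i _ => ?_) (hη.contMDiff_algD _ x₀)
  simp only [zsmul_eq_mul]
  exact contMDiffAt_const.mul (contMDiff_mvfderiv_apply (hη.contMDiff_evalForm _) _ x₀)

theorem mlieBracket_sum_smul_mem {x : M} {K : Submodule ℝ (TSp E x)} {ι : Type*} (s : Finset ι)
    (c : ι → M → ℝ) (X : ι → VField E M) (W : VField E M)
    (hc : ∀ a ∈ s, MDifferentiableAt 𝓘(ℝ, E) 𝓘(ℝ, ℝ) (c a) x) (hc0 : ∀ a ∈ s, c a x = 0)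
    (hX : ∀ a ∈ s, X a x ∈ K) :
    VectorField.mlieBracket 𝓘(ℝ, E) (fun y => ∑ a ∈ s, c a y • X a y) W x ∈ K := by
  have : CompleteSpace E := FiniteDimensional.complete ℝ E
  classical
  induction s using Finset.induction_on with
  | empty =>
    have h := congrFun (VectorField.mlieBracket_zero_left (I := 𝓘(ℝ, E)) (W := fun y => W y)) x
    simp only [Finset.sum_empty]
    exact h ▸ K.zero_mem
  | insert a s ha ih =>
    simp only [Finset.mem_insert, forall_eq_or_imp] at hc hc0 hX
    have h1 : MDifferentiableAt 𝓘(ℝ, E) (𝓘(ℝ, E).prod 𝓘(ℝ, E))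
        (fun y => Bundle.TotalSpace.mk' E y ((c a • fun y => X a y) y)) x :=
      hc.1.smul_section ((X a).mdifferentiableAt x)
    have h2 : MDifferentiableAt 𝓘(ℝ, E) (𝓘(ℝ, E).prod 𝓘(ℝ, E))
        (fun y => Bundle.TotalSpace.mk' E y (∑ a ∈ s, c a y • X a y)) x :=
      MDifferentiableAt.sum_section fun i hi => (hc.2 i hi).smul_section ((X i).mdifferentiableAt x)
    have e : (fun y => ∑ a ∈ insert a s, c a y • X a y) =
        (c a • fun y => X a y) + fun y => ∑ a ∈ s, c a y • X a y := by
      funext y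
      exact Finset.sum_insert ha
    rw [e, VectorField.mlieBracket_add_left h1 h2,
      VectorField.mlieBracket_smul_left hc.1 ((X a).mdifferentiableAt x), hc0.1, zero_smul, add_zero]
    exact K.add_mem (K.smul_mem _ hX.1) (ih hc.2 hc0.2 hX.2)

end SmoothExteriorDerivative

namespace FilteredManifold

open scoped Topology

variable {E : Type*} [NormedAddCommGroup E] [NormedSpace ℝ E] [FiniteDimensional ℝ E]
  {M : Type*} [TopologicalSpace M] [ChartedSpace E M] [IsManifold 𝓘(ℝ, E) ∞ M] [T2Space M]
  (F : FilteredManifold E M)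

/-- Every vector in `H^i_x` extends to a smooth section of `H^i`. -/
theorem exists_section {i : ℕ} {x : M} {v : TSp E x} (hv : v ∈ F.H i x) :
    ∃ V : VField E M, (∀ y, V y ∈ F.H i y) ∧ V x = v := by
  obtain ⟨U, hU, hx, r, X, hX, hspan⟩ := F.subbundle i x
  rw [← (hspan x hx).2, Submodule.mem_span_range_iff_exists_fun] at hv
  obtain ⟨c, rfl⟩ := hv
  obtain ⟨ψ, h1, h0, h⟩ := exists_vfield_eq_smul (E := E) hU hx
  choose V hV using fun a => h (X a) (hX a)
  refine ⟨∑ a, c a • V a, fun y => ?_, ?_⟩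
  · change VField.eval y (∑ a, c a • V a) ∈ _
    rw [map_sum]
    refine Submodule.sum_mem _ fun a _ => Submodule.smul_mem _ _ ?_
    rw [hV]
    by_cases hy : y ∈ U
    · rw [← (hspan y hy).2]
      exact Submodule.smul_mem _ _ (Submodule.subset_span ⟨a, rfl⟩)
    · rw [h0 y hy, zero_smul]
      exact Submodule.zero_mem _
  · change VField.eval x (∑ a, c a • V a) = _
    rw [map_sum]
    refine Finset.sum_congr rfl fun a _ => ?_
    rw [map_smul]
    exact congrArg (c a • ·) ((hV a x).trans (by rw [h1.self_of_nhds, one_smul]))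

/-- Near every point there is a frame adapted to the filtration which consists of globally defined
sections of the subbundles. -/
theorem exists_local_frame (x₀ : M) : ∃ (n : ℕ) (X : Fin n → VField E M) (wt : Fin n → ℕ)
    (b : Module.Basis (Fin n) ℝ (TSp E x₀)), (∀ a, b a = X a x₀) ∧
    (∀ a y, X a y ∈ F.H (wt a) y) ∧ ∀ᶠ y in 𝓝 x₀, LinearIndependent ℝ (fun a => X a y) ∧
      ∀ i, Submodule.span ℝ ((fun a => X a y) '' {a | wt a ≤ i}) = F.H i y := by
  obtain ⟨n, b, wt, hbH, hbs⟩ := exists_basis_adapted (fun i => F.H i x₀) (F.H_mono x₀)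
    (F.H_zero x₀) F.s (F.H_top F.s le_rfl x₀)
  choose X hXH hX using fun a => F.exists_section (hbH a)
  refine ⟨n, X, wt, b, fun a => (hX a).symm, hXH, ?_⟩
  have hli := (exists_smooth_coefficients (fun a => (X a).contMDiff x₀) b
    (fun a => (hX a).symm)).1
  have hrank : ∀ i, ∀ᶠ y in 𝓝 x₀, Module.finrank ℝ (F.H i y) = Module.finrank ℝ (F.H i x₀) := by
    intro i
    obtain ⟨U, hU, hx, r, Z, -, hspan⟩ := F.subbundle i x₀
    have : ∀ y ∈ U, Module.finrank ℝ (F.H i y) = r := by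
      intro y hy
      rw [← (hspan y hy).2, finrank_span_eq_card (hspan y hy).1, Fintype.card_fin]
    filter_upwards [hU.mem_nhds hx] with y hy
    rw [this y hy, this x₀ hx]
  have hrank' : ∀ᶠ y in 𝓝 x₀, ∀ i ∈ Finset.range (F.s + 1),
      Module.finrank ℝ (F.H i y) = Module.finrank ℝ (F.H i x₀) :=
    (Filter.eventually_all_finset _).mpr fun i _ => hrank i
  have hcard : ∀ y, LinearIndependent ℝ (fun a => X a y) → ∀ i, Module.finrank ℝ
      (Submodule.span ℝ ((fun a => X a y) '' {a | wt a ≤ i})) = Fintype.card {a | wt a ≤ i} := by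
    intro y hy i
    rw [Set.image_eq_range]
    exact finrank_span_eq_card (hy.comp _ Subtype.val_injective)
  filter_upwards [hli, hrank'] with y hy hr
  have hle : ∀ i, Submodule.span ℝ ((fun a => X a y) '' {a | wt a ≤ i}) ≤ F.H i y := by
    intro i
    rw [Submodule.span_le]
    rintro _ ⟨a, ha, rfl⟩
    exact F.H_mono y ha (hXH a y)
  have heq : ∀ i ≤ F.s, Submodule.span ℝ ((fun a => X a y) '' {a | wt a ≤ i}) = F.H i y := by
    intro i hi
    refine Submodule.eq_of_le_of_finrank_eq (hle i) ?_
    rw [hr i (Finset.mem_range.mpr (by omega)), ← hbs i, hcard y hy,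
      ← hcard x₀ hli.self_of_nhds]
    have hXb : (fun a => X a x₀) = b := funext hX
    rw [hXb]
  refine ⟨hy, fun i => ?_⟩
  rcases le_total i F.s with h | h
  · exact heq i h
  · refine le_antisymm (hle i) ?_
    rw [F.H_top i h, ← F.H_top F.s le_rfl, ← heq F.s le_rfl]
    exact Submodule.span_mono (Set.image_mono fun a (ha : wt a ≤ F.s) => ha.trans h)

/-- The bracket of a section of `H^i` vanishing at `x` with any vector field lies in `H^i_x`. -/
theorem mlieBracket_mem_of_apply_eq_zero {i : ℕ} {x : M} {V : VField E M}
    (hV : ∀ y, V y ∈ F.H i y) (hx : V x = 0) (W : VField E M) :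
    VectorField.mlieBracket 𝓘(ℝ, E) V W x ∈ F.H i x := by
  obtain ⟨n, X, wt, b, hb, hXH, hev⟩ := F.exists_local_frame x
  obtain ⟨c, hc, hce⟩ := (exists_smooth_coefficients (fun a => (X a).contMDiff x) b hb).2 _
    (V.contMDiff x)
  have hc0 : ∀ a, c a x = 0 := by
    have h := hce.self_of_nhds
    rw [hx] at h
    exact Fintype.linearIndependent_iff.mp hev.self_of_nhds.1 _ h.symm
  have e : ⇑V =ᶠ[𝓝 x]
      fun y => ∑ a ∈ Finset.univ.filter (fun a => wt a ≤ i), c a y • X a y := by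
    filter_upwards [hev, hce] with y hy hcy
    have hm := hV y
    rw [← hy.2 i, Finsupp.mem_span_image_iff_linearCombination] at hm
    obtain ⟨l, hl, hle⟩ := hm
    have hcl : l = Finsupp.equivFunOnFinite.symm fun a => c a y := by
      apply hy.1
      rw [hle, hcy]
      exact ((Finsupp.linearCombination_eq_fintype_linearCombination_apply ℝ
        (fun a => X a y) (fun a => c a y)).trans rfl).symm
    refine hcy.trans (Finset.sum_subset (Finset.subset_univ _) fun a _ ha => ?_).symm
    have : c a y = l a := by rw [hcl]; rfl
    rw [this, Finsupp.notMem_support_iff.mp fun h => ha (by simpa using hl h), zero_smul]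
  have h := Filter.EventuallyEq.mlieBracket_vectorField_eq e
    (Filter.EventuallyEq.refl (𝓝 x) ⇑W)
  refine (congrArg (· ∈ F.H i x) h).mpr ?_
  refine mlieBracket_sum_smul_mem _ c X W (fun a _ => (hc a).mdifferentiableAt (by simp))
    (fun a _ => hc0 a) fun a ha => ?_
  exact F.H_mono x (Finset.mem_filter.mp ha).2 (hXH a x)

/-- The class of `[V, W](x)` in `H^{i+j}_x / H^{i+j-1}_x`, for `V ∈ Γ(H^i)` and `W ∈ Γ(H^j)`, does
not depend on the representative of the class of `V(x)`. -/
theorem mlieBracket_mem_pred {i j : ℕ} {x : M} {V W : VField E M} (hV : ∀ y, V y ∈ F.H i y)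
    (hx : V x ∈ F.H (i - 1) x) (hW : ∀ y, W y ∈ F.H j y) :
    VectorField.mlieBracket 𝓘(ℝ, E) V W x ∈ F.H (i + j - 1) x := by
  have : CompleteSpace E := FiniteDimensional.complete ℝ E
  rcases Nat.eq_zero_or_pos i with rfl | hi
  · have h := F.bracket_mem 0 j V W hV hW x
    have : ⇑V = 0 := funext fun y => by simpa [F.H_zero] using hV y
    rw [this, VectorField.mlieBracket_zero_left]
    exact Submodule.zero_mem _
  rcases Nat.eq_zero_or_pos j with rfl | hj
  · have : ⇑W = 0 := funext fun y => by simpa [F.H_zero] using hW y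
    rw [this, VectorField.mlieBracket_zero_right]
    exact Submodule.zero_mem _
  obtain ⟨V', hV', hx'⟩ := F.exists_section hx
  have e : ⇑V = ⇑(V - V') + ⇑V' := by
    rw [← ContMDiffSection.coe_add, sub_add_cancel]
  rw [e, VectorField.mlieBracket_add_left ((V - V').mdifferentiableAt x) (V'.mdifferentiableAt x)]
  refine Submodule.add_mem _ ?_ ?_
  · refine F.H_mono x (by omega) (F.mlieBracket_mem_of_apply_eq_zero (i := i) (fun y => ?_) ?_ W)
    · simpa using Submodule.sub_mem _ (hV y) (F.H_mono y (Nat.sub_le i 1) (hV' y))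
    · simp [hx']
  · have h := F.bracket_mem (i - 1) j V' W hV' hW x
    rwa [show i - 1 + j = i + j - 1 by omega] at h

end FilteredManifold

/-! ### The graded tangent space and the osculating bracket -/

namespace FilteredManifold

variable {E : Type*} [NormedAddCommGroup E] [NormedSpace ℝ E]
  {M : Type*} [TopologicalSpace M] [ChartedSpace E M] [IsManifold 𝓘(ℝ, E) ∞ M]
  (F : FilteredManifold E M)

section Graded

theorem cls_eq_of_sub_mem {i : ℕ} {x : M} {u v : TSp E x} (hu : u ∈ F.H i x) (hv : v ∈ F.H i x)
    (h : u - v ∈ F.H (i - 1) x) : F.cls i u hu = F.cls i v hv :=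
  congrArg (DirectSum.lof ℝ ℕ (fun i => ↥(F.H i x) ⧸ (F.H (i - 1) x).submoduleOf (F.H i x)) i)
    ((Submodule.Quotient.eq _).mpr h)

theorem cls_zero (i : ℕ) (x : M) : F.cls i (0 : TSp E x) (Submodule.zero_mem _) = 0 :=
  map_zero (DirectSum.lof ℝ ℕ (fun i => ↥(F.H i x) ⧸ (F.H (i - 1) x).submoduleOf (F.H i x)) i)

theorem cls_eq_zero {i : ℕ} {x : M} {v : TSp E x} (hv : v ∈ F.H i x) (h : v ∈ F.H (i - 1) x) :
    F.cls i v hv = 0 := by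
  rw [F.cls_eq_of_sub_mem hv (Submodule.zero_mem _) (by simpa using h), cls_zero]

theorem cls_eq_zero_of_lt {i : ℕ} {x : M} {v : TSp E x} (hv : v ∈ F.H i x) (h : F.s < i) :
    F.cls i v hv = 0 :=
  F.cls_eq_zero hv (by rw [F.H_top (i - 1) (by omega)]; trivial)

/-- The projection `H^i_x → H^i_x / H^{i-1}_x`, with values in the graded tangent space. -/
def clsHom (x : M) (i : ℕ) : F.H i x →ₗ[ℝ] F.Gr x where
  toFun v := F.cls i v v.2
  map_add' u v := map_add
    (DirectSum.lof ℝ ℕ (fun i => ↥(F.H i x) ⧸ (F.H (i - 1) x).submoduleOf (F.H i x)) i)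
    (Submodule.Quotient.mk u) (Submodule.Quotient.mk v)
  map_smul' c v := map_smul
    (DirectSum.lof ℝ ℕ (fun i => ↥(F.H i x) ⧸ (F.H (i - 1) x).submoduleOf (F.H i x)) i)
    c (Submodule.Quotient.mk v)

/-- The component of degree `i` of an element of the graded tangent space. -/
def component (x : M) (i : ℕ) :
    F.Gr x →ₗ[ℝ] ↥(F.H i x) ⧸ (F.H (i - 1) x).submoduleOf (F.H i x) :=
  DirectSum.component ℝ ℕ (fun i => ↥(F.H i x) ⧸ (F.H (i - 1) x).submoduleOf (F.H i x)) i

theorem component_cls {x : M} {i : ℕ} {v : TSp E x} (hv : v ∈ F.H i x) :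
    F.component x i (F.cls i v hv) = Submodule.Quotient.mk ⟨v, hv⟩ :=
  DirectSum.component.lof_self ..

theorem component_cls_of_ne {x : M} {i a : ℕ} {v : TSp E x} (hv : v ∈ F.H a x) (h : i ≠ a) :
    F.component x i (F.cls a v hv) = 0 :=
  (DirectSum.component.of ..).trans (dif_neg h.symm)

/-- A linear extension to `T_x M` of the map sending a vector of `H^i_x` to its class. -/
theorem exists_clsLin (x : M) (i : ℕ) : ∃ C : TSp E x →ₗ[ℝ] F.Gr x,
    ∀ v (hv : v ∈ F.H i x), C v = F.cls i v hv := by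
  obtain ⟨C, hC⟩ := LinearMap.exists_extend (F.clsHom x i)
  exact ⟨C, fun v hv => LinearMap.congr_fun hC ⟨v, hv⟩⟩

/-- A linear extension to `T_x M` of the map sending a vector of `H^i_x` to its class. -/
def clsLin (x : M) (i : ℕ) : TSp E x →ₗ[ℝ] F.Gr x := (F.exists_clsLin x i).choose

theorem clsLin_apply {x : M} {i : ℕ} {v : TSp E x} (hv : v ∈ F.H i x) :
    F.clsLin x i v = F.cls i v hv := (F.exists_clsLin x i).choose_spec v hv

/-- Multilinear maps on the graded tangent space are determined by their values on classes. -/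
theorem alternatingMap_ext_cls {N : Type*} [AddCommGroup N] [Module ℝ N] {k : ℕ} {x : M}
    {f g : F.Gr x [⋀^Fin k]→ₗ[ℝ] N}
    (h : ∀ (i : Fin k → ℕ) (v : Fin k → TSp E x) (hv : ∀ j, v j ∈ F.H (i j) x),
      f (fun j => F.cls (i j) (v j) (hv j)) = g (fun j => F.cls (i j) (v j) (hv j))) : f = g := by
  have hspan : Submodule.span ℝ {u : F.Gr x | ∃ i v hv, u = F.cls i v hv} = ⊤ := by
    rw [eq_top_iff]
    intro u _
    refine DirectSum.induction_on u (Submodule.zero_mem _) (fun i q => ?_)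
      (fun u v hu hv => Submodule.add_mem _ hu hv)
    obtain ⟨⟨v, hv⟩, rfl⟩ := Submodule.Quotient.mk_surjective _ q
    exact Submodule.subset_span ⟨i, v, hv, rfl⟩
  ext u
  rw [← sub_eq_zero]
  refine (f.toMultilinearMap - g.toMultilinearMap).eq_zero_of_mem_span
    (fun _ => {u : F.Gr x | ∃ i v hv, u = F.cls i v hv}) (fun u hu => ?_) u
    (fun j => hspan ▸ Submodule.mem_top)
  choose i v hv hu using hu
  obtain rfl : u = fun j => F.cls (i j) (v j) (hv j) := funext hu
  exact sub_eq_zero.mpr (h i v hv)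

/-- Linear right inverses of the projections `H^i_x → H^i_x / H^{i-1}_x`. -/
theorem exists_representative (x : M) (i : ℕ) : ∃ T : F.Gr x →ₗ[ℝ] F.H i x,
    (∀ v (hv : v ∈ F.H i x), ↑(T (F.cls i v hv)) - v ∈ F.H (i - 1) x) ∧
    ∀ a v (hv : v ∈ F.H a x), i ≠ a → T (F.cls a v hv) = 0 := by
  obtain ⟨σ, hσ⟩ := ((F.H (i - 1) x).submoduleOf (F.H i x)).mkQ.exists_rightInverse_of_surjective
    (Submodule.range_mkQ _)
  refine ⟨σ ∘ₗ F.component x i, fun v hv => ?_, fun a v hv h => ?_⟩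
  · rw [LinearMap.comp_apply, component_cls]
    have h := LinearMap.congr_fun hσ (Submodule.Quotient.mk ⟨v, hv⟩)
    exact (Submodule.Quotient.eq ((F.H (i - 1) x).submoduleOf (F.H i x))).mp h
  · rw [LinearMap.comp_apply, F.component_cls_of_ne hv h, map_zero]

/-- A linear choice of representatives in `H^i_x` of the component of degree `i`. -/
def representative (x : M) (i : ℕ) : F.Gr x →ₗ[ℝ] F.H i x := (F.exists_representative x i).choose

theorem representative_sub_mem {x : M} {i : ℕ} {v : TSp E x} (hv : v ∈ F.H i x) :
    ↑(F.representative x i (F.cls i v hv)) - v ∈ F.H (i - 1) x :=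
  (F.exists_representative x i).choose_spec.1 v hv

theorem representative_of_ne {x : M} {i a : ℕ} {v : TSp E x} (hv : v ∈ F.H a x) (h : i ≠ a) :
    F.representative x i (F.cls a v hv) = 0 :=
  (F.exists_representative x i).choose_spec.2 a v hv h

theorem gradedSum_cls {L N : Type*} [AddCommGroup L] [Module ℝ L] [AddCommGroup N] [Module ℝ N]
    {k : ℕ} {x : M} (β : ℕ → L [⋀^Fin k]→ₗ[ℝ] N) (T : ℕ → F.Gr x →ₗ[ℝ] L)
    (hT : ∀ i a v (hv : v ∈ F.H a x), i ≠ a → T i (F.cls a v hv) = 0)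
    (i : Fin k → ℕ) (v : Fin k → TSp E x) (hv : ∀ j, v j ∈ F.H (i j) x) :
    gradedSum F.s β T (fun j => F.cls (i j) (v j) (hv j)) =
      β (∑ j, i j) (fun j => T (i j) (F.cls (i j) (v j) (hv j))) := by
  refine gradedSum_apply β T _ i (fun j a ha => hT _ _ _ _ ha) fun j hj => ?_
  rw [F.cls_eq_zero_of_lt _ hj, map_zero]

end Graded

section Bracket

variable [FiniteDimensional ℝ E] [T2Space M]

/-- The sections of `H^i`. -/
def sections (i : ℕ) : Submodule ℝ (VField E M) where
  carrier := {V | ∀ y, V y ∈ F.H i y}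
  zero_mem' _ := Submodule.zero_mem _
  add_mem' hV hW y := Submodule.add_mem _ (hV y) (hW y)
  smul_mem' c _ hV y := Submodule.smul_mem _ c (hV y)

/-- Vectors in `H^i_x` extend linearly to sections of `H^i`. -/
theorem exists_extension (x : M) (i : ℕ) : ∃ T : F.H i x →ₗ[ℝ] VField E M,
    (∀ v y, T v y ∈ F.H i y) ∧ ∀ v, T v x = v := by
  let ev : F.sections i →ₗ[ℝ] F.H i x :=
    ((VField.eval x).domRestrict (F.sections i)).codRestrict (F.H i x) fun V => V.2 x
  have hev : LinearMap.range ev = ⊤ := by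
    rw [LinearMap.range_eq_top]
    intro v
    obtain ⟨V, hV, hx⟩ := F.exists_section v.2
    exact ⟨⟨V, hV⟩, Subtype.ext hx⟩
  obtain ⟨σ, hσ⟩ := ev.exists_rightInverse_of_surjective hev
  refine ⟨(F.sections i).subtype ∘ₗ σ, fun v y => (σ v).2 y, fun v => ?_⟩
  exact congrArg Subtype.val (LinearMap.congr_fun hσ v)

/-- The class of `[V, W](x)` only depends on the classes of `V(x)` and `W(x)`. -/
theorem mlieBracket_sub_mem {i j : ℕ} {x : M} {V V' W W' : VField E M}
    (hV : ∀ y, V y ∈ F.H i y) (hV' : ∀ y, V' y ∈ F.H i y) (hW : ∀ y, W y ∈ F.H j y)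
    (hW' : ∀ y, W' y ∈ F.H j y) (hVx : V x - V' x ∈ F.H (i - 1) x)
    (hWx : W x - W' x ∈ F.H (j - 1) x) :
    VectorField.mlieBracket 𝓘(ℝ, E) V W x - VectorField.mlieBracket 𝓘(ℝ, E) V' W' x ∈
      F.H (i + j - 1) x := by
  have : CompleteSpace E := FiniteDimensional.complete ℝ E
  have h1 := F.mlieBracket_mem_pred (V := V - V') (W := W)
    (fun y => Submodule.sub_mem _ (hV y) (hV' y)) hVx hW
  have h2 := F.mlieBracket_mem_pred (V := W - W') (W := V')
    (fun y => Submodule.sub_mem _ (hW y) (hW' y)) hWx hV'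
  rw [add_comm j i] at h2
  have e1 := VectorField.mlieBracket_add_left (W := ⇑W) ((V - V').mdifferentiableAt x)
    (V'.mdifferentiableAt x)
  have e2 := VectorField.mlieBracket_add_left (W := ⇑V') ((W - W').mdifferentiableAt x)
    (W'.mdifferentiableAt x)
  rw [← ContMDiffSection.coe_add, sub_add_cancel] at e1 e2
  have e3 : VectorField.mlieBracket 𝓘(ℝ, E) V W x - VectorField.mlieBracket 𝓘(ℝ, E) V' W' x =
      VectorField.mlieBracket 𝓘(ℝ, E) ⇑(V - V') W x
        - VectorField.mlieBracket 𝓘(ℝ, E) ⇑(W - W') V' x := by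
    rw [VectorField.mlieBracket_swap_apply] at e2
    rw [VectorField.mlieBracket_swap_apply (V := ⇑W')] at e2
    rw [e1, neg_eq_iff_eq_neg.mp e2]
    abel
  rw [e3]
  exact Submodule.sub_mem _ h1 h2

theorem exists_isOscBracket (x : M) : ∃ B, F.IsOscBracket x B := by
  choose T hT hTx using F.exists_extension x
  let R : ℕ → F.Gr x →ₗ[ℝ] VField E M := fun i => T i ∘ₗ F.representative x i
  refine ⟨gradedSum F.s (fun m => (F.clsLin x m ∘ₗ VField.eval x).compAlternatingMap vfBracket) R,
    fun i j V W hV hW => ?_⟩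
  have hv : ∀ l, (![V x, W x] : Fin 2 → TSp E x) l ∈ F.H ((![i, j] : Fin 2 → ℕ) l) x := by
    intro l
    fin_cases l
    · exact hV x
    · exact hW x
  have e : ![F.cls i (V x) (hV x), F.cls j (W x) (hW x)] =
      fun l => F.cls ((![i, j] : Fin 2 → ℕ) l) ((![V x, W x] : Fin 2 → TSp E x) l) (hv l) := by
    funext l
    fin_cases l <;> rfl
  rw [e, F.gradedSum_cls _ _ (fun i a v hv h => by
    simp [R, F.representative_of_ne hv h])]
  let V' := T i (F.representative x i (F.cls i (V x) (hV x)))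
  let W' := T j (F.representative x j (F.cls j (W x) (hW x)))
  have e' : (fun l => R ((![i, j] : Fin 2 → ℕ) l)
      (F.cls ((![i, j] : Fin 2 → ℕ) l) ((![V x, W x] : Fin 2 → TSp E x) l) (hv l))) =
      ![V', W'] := by
    funext l
    fin_cases l <;> rfl
  have hs : ∑ l, (![i, j] : Fin 2 → ℕ) l = i + j := by simp
  rw [e', hs]
  change F.clsLin x (i + j) (VectorField.mlieBracket 𝓘(ℝ, E) V' W' x) = _
  rw [F.clsLin_apply (F.bracket_mem i j V' W' (hT i _) (hT j _) x)]
  refine F.cls_eq_of_sub_mem _ _ (F.mlieBracket_sub_mem (hT i _) hV (hT j _) hW ?_ ?_)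
  · rw [hTx]
    exact F.representative_sub_mem (hV x)
  · rw [hTx]
    exact F.representative_sub_mem (hW x)

/-- The commutator of vector fields induces a well-defined bracket on the graded tangent space. -/
theorem isOscBracket_oscBracket (x : M) : F.IsOscBracket x (F.oscBracket x) := by
  rw [oscBracket, dif_pos (F.exists_isOscBracket x)]
  exact (F.exists_isOscBracket x).choose_spec

end Bracket

end FilteredManifold

/-! ### Osculating forms as symbols of forms -/

section GrPiece

variable {A B : Type*} [AddCommGroup A] [Module ℝ A] [AddCommGroup B] [Module ℝ B]

/-- A surjective map from `FA w` with kernel `FA (w + 1)` identifies the graded piece. -/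
def grPieceEquiv (FA : ℕ → Submodule ℝ A) (w : ℕ) (C : Submodule ℝ B) (f : FA w →ₗ[ℝ] C)
    (hker : LinearMap.ker f = (FA (w + 1)).submoduleOf (FA w)) (hf : Function.Surjective f) :
    GrPiece FA w ≃ₗ[ℝ] C :=
  LinearEquiv.ofBijective (((FA (w + 1)).submoduleOf (FA w)).liftQ f hker.ge)
    ⟨LinearMap.ker_eq_bot.mp (Submodule.ker_liftQ_eq_bot' _ _ hker.symm),
      fun b => (hf b).imp' Submodule.Quotient.mk fun _ h => h⟩

theorem grPieceEquiv_mk (FA : ℕ → Submodule ℝ A) (w : ℕ) (C : Submodule ℝ B) (f : FA w →ₗ[ℝ] C)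
    (hker : LinearMap.ker f = (FA (w + 1)).submoduleOf (FA w)) (hf : Function.Surjective f)
    (a : FA w) : grPieceEquiv FA w C f hker hf (Submodule.Quotient.mk a) = f a := rfl

end GrPiece

/-- Alternating maps on tangent spaces are continuous. -/
theorem continuous_alternatingMap {E : Type*} [NormedAddCommGroup E] [NormedSpace ℝ E]
    [FiniteDimensional ℝ E] {M : Type*} [TopologicalSpace M] [ChartedSpace E M] {n k : ℕ} {x : M} (b : Module.Basis (Fin n) ℝ (TSp E x))
    (β : TSp E x [⋀^Fin k]→ₗ[ℝ] ℝ) : Continuous β := by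
  have : T2Space (TSp E x) := inferInstanceAs (T2Space E)
  have e : (β : (Fin k → TSp E x) → ℝ) = fun v => ∑ r : Fin k → Fin n,
      (∏ j, b.coord (r j) (v j)) * β (fun j => b (r j)) := by
    funext v
    conv_lhs => rw [show v = fun j => ∑ a, b.coord a (v j) • b a from
      funext fun j => (b.sum_repr (v j)).symm]
    exact AlternatingMap.apply_sum_smul b β _
  rw [e]
  refine continuous_finsetSum _ fun r _ => Continuous.mul ?_ continuous_const
  refine continuous_finsetProd _ fun j _ => ?_
  exact (LinearMap.continuous_of_finiteDimensional _).comp (continuous_apply j)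

namespace FilteredManifold

variable {E : Type*} [NormedAddCommGroup E] [NormedSpace ℝ E]
  {M : Type*} [TopologicalSpace M] [ChartedSpace E M] [IsManifold 𝓘(ℝ, E) ∞ M]
  (F : FilteredManifold E M)

/-- A multilinear map of weight at least `w` only depends, on vectors of total weight `w`, on
their classes in the graded tangent space. -/
theorem map_eq_of_sub_mem {N : Type*} [AddCommGroup N] [Module ℝ N] {k w : ℕ} {x : M}
    (β : MultilinearMap ℝ (fun _ : Fin k => TSp E x) N)
    (hβ : ∀ (i : Fin k → ℕ) (v : Fin k → TSp E x), (∀ j, v j ∈ F.H (i j) x) → ∑ j, i j < w →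
      β v = 0)
    {i : Fin k → ℕ} (hi : ∑ j, i j = w) {u v : Fin k → TSp E x} (hu : ∀ j, u j ∈ F.H (i j) x)
    (hv : ∀ j, v j ∈ F.H (i j) x) (h : ∀ j, u j - v j ∈ F.H (i j - 1) x) : β u = β v := by
  classical
  have key : ∀ s : Finset (Fin k), β (s.piecewise u v) = β v := by
    intro s
    induction s using Finset.induction_on with
    | empty => rw [Finset.piecewise_empty]
    | insert a s ha ih =>
      rw [← ih, Finset.piecewise_insert, ← sub_eq_zero]
      have hm : Function.update (s.piecewise u v) a (v a) = s.piecewise u v := by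
        rw [← Finset.piecewise_eq_of_notMem s u v ha, Function.update_eq_self]
      have hd : β (Function.update (s.piecewise u v) a (u a)) - β (s.piecewise u v) =
          β (Function.update (s.piecewise u v) a (u a - v a)) := by
        rw [β.map_update_sub, hm]
      rw [hd]
      have hs : ∀ j, s.piecewise u v j ∈ F.H (i j) x := fun j => by
        by_cases hj : j ∈ s
        · rw [Finset.piecewise_eq_of_mem _ _ _ hj]; exact hu j
        · rw [Finset.piecewise_eq_of_notMem _ _ _ hj]; exact hv j
      rcases Nat.eq_zero_or_pos (i a) with h0 | h0
      · have h1 : u a - v a = 0 := by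
          have := h a
          rwa [h0, F.H_zero, Submodule.mem_bot] at this
        exact β.map_coord_zero a (by rw [Function.update_self, h1])
      · refine hβ (Function.update i a (i a - 1)) _ (fun j => ?_) ?_
        · rcases eq_or_ne j a with rfl | hj
          · simpa using h j
          · simpa [hj] using hs j
        · rw [← hi]
          refine Finset.sum_lt_sum (fun j _ => ?_) ⟨a, Finset.mem_univ a, ?_⟩
          · rcases eq_or_ne j a with rfl | hj <;> simp [*]
          · simpa using h0
  simpa using key Finset.univ

/-- The component of weight `w` on `gr (T_x M)` of an alternating form on `T_x M`. -/
def symbolAt {k : ℕ} (w : ℕ) {x : M} (β : TSp E x [⋀^Fin k]→ₗ[ℝ] ℝ) : F.Gr x [⋀^Fin k]→ₗ[ℝ] ℝ :=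
  gradedSum F.s (fun m => if m = w then β else 0)
    (fun i => (F.H i x).subtype ∘ₗ F.representative x i)

theorem symbolAt_cls {k w : ℕ} {x : M} {β : TSp E x [⋀^Fin k]→ₗ[ℝ] ℝ}
    (hβ : ∀ (i : Fin k → ℕ) (v : Fin k → TSp E x), (∀ j, v j ∈ F.H (i j) x) → ∑ j, i j < w →
      β v = 0)
    (i : Fin k → ℕ) (v : Fin k → TSp E x) (hv : ∀ j, v j ∈ F.H (i j) x) :
    F.symbolAt w β (fun j => F.cls (i j) (v j) (hv j)) = if ∑ j, i j = w then β v else 0 := by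
  rw [symbolAt, F.gradedSum_cls _ _ (fun i a v hv h => by
    rw [LinearMap.comp_apply, F.representative_of_ne hv h, map_zero])]
  split_ifs with h
  · exact F.map_eq_of_sub_mem β.toMultilinearMap hβ h (fun j => Subtype.coe_prop _) hv
      fun j => F.representative_sub_mem (hv j)
  · rfl

variable [FiniteDimensional ℝ E]

/-- The map from forms of weight at least `w` to osculating forms of weight `w`. -/
def symbol (k w : ℕ) : F.formGE k w →ₗ[ℝ] F.oscForm k w where
  toFun η := ⟨fun x => F.symbolAt w ((η : FormField E M k) x).toAlternatingMap, by
    refine ⟨fun i V hV => ?_, fun x i v hv h => ?_⟩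
    · by_cases h : ∑ j, i j = w
      · refine (η.2.1.contMDiff_evalForm V).congr fun x => ?_
        exact (F.symbolAt_cls (η.2.2 x) i (fun j => V j x) fun j => hV j x).trans (if_pos h)
      · refine contMDiff_const (c := (0 : ℝ)).congr fun x => ?_
        exact (F.symbolAt_cls (η.2.2 x) i (fun j => V j x) fun j => hV j x).trans (if_neg h)
    · exact (F.symbolAt_cls (η.2.2 x) i v hv).trans (if_neg h)⟩
  map_add' η θ := by
    refine Subtype.ext (funext fun x => F.alternatingMap_ext_cls fun i v hv => ?_)
    refine (F.symbolAt_cls ((η + θ).2.2 x) i v hv).trans ?_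
    refine Eq.trans ?_ (congrArg₂ (· + ·) (F.symbolAt_cls (η.2.2 x) i v hv)
      (F.symbolAt_cls (θ.2.2 x) i v hv)).symm
    split_ifs
    · rfl
    · exact (add_zero _).symm
  map_smul' c η := by
    refine Subtype.ext (funext fun x => F.alternatingMap_ext_cls fun i v hv => ?_)
    refine (F.symbolAt_cls ((c • η).2.2 x) i v hv).trans ?_
    refine Eq.trans ?_ (congrArg (c • ·) (F.symbolAt_cls (η.2.2 x) i v hv)).symm
    split_ifs
    · rfl
    · exact (smul_zero _).symm

theorem symbol_cls {k w : ℕ} (η : F.formGE k w) {x : M} (i : Fin k → ℕ) (v : Fin k → TSp E x)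
    (hv : ∀ j, v j ∈ F.H (i j) x) :
    (F.symbol k w η : F.OscField k) x (fun j => F.cls (i j) (v j) (hv j)) =
      if ∑ j, i j = w then (η : FormField E M k) x v else 0 :=
  F.symbolAt_cls (η.2.2 x) i v hv

theorem ker_symbol (k w : ℕ) :
    LinearMap.ker (F.symbol k w) = (F.formGE k (w + 1)).submoduleOf (F.formGE k w) := by
  ext η
  change F.symbol k w η = 0 ↔ (η : FormField E M k) ∈ F.formGE k (w + 1)
  constructor
  · refine fun h => ⟨η.2.1, fun x i v hv hi => ?_⟩
    rcases (Nat.lt_succ_iff.mp hi).lt_or_eq with h' | h'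
    · exact η.2.2 x i v hv h'
    · have e := F.symbol_cls η i v hv
      rw [if_pos h', h] at e
      exact e.symm
  · refine fun h => Subtype.ext (funext fun x => F.alternatingMap_ext_cls fun i v hv => ?_)
    refine (F.symbol_cls η i v hv).trans ?_
    split_ifs with h'
    · exact h.2 x i v hv (by omega)
    · rfl

/-- Alternating forms of weight `w` on the graded tangent space lift to forms on the tangent
space, with prescribed values on an adapted frame. -/
theorem exists_lift {n k w : ℕ} {x : M} (X : Fin n → TSp E x) (wt : Fin n → ℕ)
    (hX : ∀ a, X a ∈ F.H (wt a) x) (hli : LinearIndependent ℝ X)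
    (hsp : ∀ i, Submodule.span ℝ (X '' {a | wt a ≤ i}) = F.H i x)
    (α : F.Gr x [⋀^Fin k]→ₗ[ℝ] ℝ)
    (hα : ∀ (i : Fin k → ℕ) (v : Fin k → TSp E x) (hv : ∀ j, v j ∈ F.H (i j) x),
      ∑ j, i j ≠ w → α (fun j => F.cls (i j) (v j) (hv j)) = 0) :
    ∃ θ : TSp E x [⋀^Fin k]→L[ℝ] ℝ,
      (∀ r : Fin k → Fin n, θ (fun j => X (r j)) =
        α (fun j => F.cls (wt (r j)) (X (r j)) (hX (r j)))) ∧
      ∀ (i : Fin k → ℕ) (v : Fin k → TSp E x) (hv : ∀ j, v j ∈ F.H (i j) x), ∑ j, i j ≤ w →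
        θ v = α (fun j => F.cls (i j) (v j) (hv j)) := by
  have htop : ⊤ ≤ Submodule.span ℝ (Set.range X) := by
    rw [← F.H_top F.s le_rfl x, ← hsp F.s]
    exact Submodule.span_mono (Set.image_subset_range _ _)
  let b := Module.Basis.mk hli htop
  let ψ : TSp E x →ₗ[ℝ] F.Gr x := b.constr ℝ fun a => F.cls (wt a) (X a) (hX a)
  have hψ : ∀ a, ψ (X a) = F.cls (wt a) (X a) (hX a) := fun a => by
    have h := b.constr_basis ℝ (fun a => F.cls (wt a) (X a) (hX a)) a
    rwa [Module.Basis.mk_apply] at h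
  have hr : ∀ r : Fin k → Fin n, α.compLinearMap ψ (fun j => X (r j)) =
      α (fun j => F.cls (wt (r j)) (X (r j)) (hX (r j))) := fun r =>
    congrArg α (funext fun j => hψ (r j))
  refine ⟨{ α.compLinearMap ψ with cont := continuous_alternatingMap b _ }, hr,
    fun i v hv hi => ?_⟩
  have e : α.toMultilinearMap.compLinearMap (fun j => F.clsLin x (i j)) v =
      α (fun j => F.cls (i j) (v j) (hv j)) :=
    congrArg α (funext fun j => F.clsLin_apply (hv j))
  rw [← e, ← sub_eq_zero]
  refine ((α.compLinearMap ψ).toMultilinearMap -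
    α.toMultilinearMap.compLinearMap (fun j => F.clsLin x (i j))).eq_zero_of_mem_span
    (fun j => X '' {a | wt a ≤ i j}) (fun v hv => ?_) v (fun j => by rw [hsp]; exact hv j)
  choose r hr' hv using hv
  obtain rfl : (fun j => X (r j)) = v := funext hv
  have hmem : ∀ j, X (r j) ∈ F.H (i j) x := fun j => F.H_mono x (hr' j) (hX _)
  rw [sub_apply, sub_eq_zero]
  refine (hr r).trans ?_
  have e' : α.toMultilinearMap.compLinearMap (fun j => F.clsLin x (i j)) (fun j => X (r j)) =
      α (fun j => F.cls (i j) (X (r j)) (hmem j)) :=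
    congrArg α (funext fun j => F.clsLin_apply (hmem j))
  rw [e']
  by_cases h : ∀ j, wt (r j) = i j
  · obtain rfl : (fun j => wt (r j)) = i := funext h
    rfl
  · obtain ⟨j, hj⟩ := not_forall.mp h
    have hlt : wt (r j) < i j := lt_of_le_of_ne (hr' j) hj
    have hsum : ∑ j, wt (r j) < ∑ j, i j :=
      Finset.sum_lt_sum (fun l _ => hr' l) ⟨j, Finset.mem_univ j, hlt⟩
    rw [hα (fun j => wt (r j)) _ _ (by omega)]
    refine (α.map_coord_zero j ?_).symm
    exact F.cls_eq_zero _ (F.H_mono x (by omega : wt (r j) ≤ i j - 1) (hX _))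

variable [T2Space M] [SigmaCompactSpace M]

theorem symbol_surjective (k w : ℕ) : Function.Surjective (F.symbol k w) := by
  intro α
  obtain ⟨θ, hθ⟩ := exists_contMDiffSection_forall_mem_convex_of_local (n := ⊤)
    (F_fiber := E [⋀^Fin k]→L[ℝ] ℝ) 𝓘(ℝ, E)
    (fun x : M => TSp E x [⋀^Fin k]→L[ℝ] Bundle.Trivial M ℝ x)
    (fun x => {θ | ∀ (i : Fin k → ℕ) (v : Fin k → TSp E x) (hv : ∀ j, v j ∈ F.H (i j) x),
      ∑ j, i j ≤ w → (θ : TSp E x [⋀^Fin k]→L[ℝ] ℝ) v =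
        (α : F.OscField k) x (fun j => F.cls (i j) (v j) (hv j))})
    (fun x θ hθ θ' hθ' a b _ _ hab i v hv hi => by
      change a • (θ : TSp E x [⋀^Fin k]→L[ℝ] ℝ) v + b • (θ' : TSp E x [⋀^Fin k]→L[ℝ] ℝ) v = _
      rw [hθ i v hv hi, hθ' i v hv hi, ← add_smul, hab, one_smul])
    (fun x₀ => by
      obtain ⟨n, X, wt, -, -, hX, hgood⟩ := F.exists_local_frame x₀
      have hex : ∀ y, ∃ θ : TSp E y [⋀^Fin k]→L[ℝ] ℝ, (LinearIndependent ℝ (fun a => X a y) ∧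
          ∀ i, Submodule.span ℝ ((fun a => X a y) '' {a | wt a ≤ i}) = F.H i y) →
          (∀ r : Fin k → Fin n, θ (fun j => X (r j) y) =
            (α : F.OscField k) y (fun j => F.cls (wt (r j)) (X (r j) y) (hX (r j) y))) ∧
          ∀ (i : Fin k → ℕ) (v : Fin k → TSp E y) (hv : ∀ j, v j ∈ F.H (i j) y), ∑ j, i j ≤ w →
            θ v = (α : F.OscField k) y (fun j => F.cls (i j) (v j) (hv j)) := by
        intro y
        by_cases h : LinearIndependent ℝ (fun a => X a y) ∧
          ∀ i, Submodule.span ℝ ((fun a => X a y) '' {a | wt a ≤ i}) = F.H i y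
        · obtain ⟨θ, hθ⟩ := F.exists_lift (fun a => X a y) wt (fun a => hX a y) h.1 h.2
            ((α : F.OscField k) y) (α.2.2 y)
          exact ⟨θ, fun _ => hθ⟩
        · exact ⟨0, fun h' => absurd h' h⟩
      choose θ hθ using hex
      obtain ⟨U, hUg, hUo, hxU⟩ := eventually_nhds_iff.mp hgood
      refine ⟨U, hUo.mem_nhds hxU, θ, fun y hy => ContMDiffAt.contMDiffWithinAt ?_,
        fun y hy => (hθ y (hUg y hy)).2⟩
      have htop : ⊤ ≤ Submodule.span ℝ (Set.range fun a => X a y) := by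
        rw [← F.H_top F.s le_rfl y, ← (hUg y hy).2 F.s]
        exact Submodule.span_mono (Set.image_subset_range _ _)
      refine contMDiffAt_form_of_frame (X := fun a => X a) (fun a => (X a).contMDiff y)
        (Module.Basis.mk (hUg y hy).1 htop) (fun a => Module.Basis.mk_apply _ _ a) fun r => ?_
      refine (α.2.1 (fun j => wt (r j)) (fun j => X (r j)) fun j => hX (r j)).contMDiffAt.congr_of_eventuallyEq
        ?_
      filter_upwards [hUo.mem_nhds hy] with z hz using (hθ z (hUg z hz)).1 r)
  refine ⟨⟨fun x => θ x, θ.contMDiff, fun x i v hv hi => ?_⟩, ?_⟩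
  · exact (hθ x i v hv hi.le).trans (α.2.2 x i v hv hi.ne)
  · refine Subtype.ext (funext fun x => F.alternatingMap_ext_cls fun i v hv => ?_)
    refine (F.symbol_cls _ i v hv).trans ?_
    split_ifs with h
    · exact hθ x i v hv h.le
    · exact (α.2.2 x i v hv h).symm

/-- The canonical identification of the graded pieces of the space of forms with the spaces of
osculating forms. -/
def symbolEquiv (k w : ℕ) : GrPiece (F.formGE k) w ≃ₗ[ℝ] F.oscForm k w :=
  grPieceEquiv (A := FormField E M k) (B := F.OscField k) (F.formGE k) w (F.oscForm k w)
    (F.symbol k w) (F.ker_symbol k w) (F.symbol_surjective k w)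

theorem symbolEquiv_mk {k w : ℕ} (η : F.formGE k w) :
    F.symbolEquiv k w (Submodule.Quotient.mk η) = F.symbol k w η :=
  grPieceEquiv_mk (A := FormField E M k) (B := F.OscField k) (F.formGE k) w (F.oscForm k w)
    (F.symbol k w) (F.ker_symbol k w) (F.symbol_surjective k w) η

theorem isCanonical_symbolEquiv : F.IsCanonical F.symbolEquiv := by
  intro k w η x i v hv
  rw [F.symbolEquiv_mk]
  exact F.symbol_cls η i v hv

end FilteredManifold

/-! ### The exterior derivative and its algebraic part -/

section ChevalleyEilenberg

variable {L N : Type*} [AddCommGroup L] [Module ℝ L] [AddCommGroup N] [Module ℝ N]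

theorem ceDiff_succ_apply {k : ℕ} (B : L [⋀^Fin 2]→ₗ[ℝ] L) (α : L [⋀^Fin (k + 1)]→ₗ[ℝ] N)
    (v : Fin (k + 2) → L) : ceDiff B α v = ceSum B α v := rfl

theorem ceDiff_add {k : ℕ} (B : L [⋀^Fin 2]→ₗ[ℝ] L) (α β : L [⋀^Fin k]→ₗ[ℝ] N) :
    ceDiff B (α + β) = ceDiff B α + ceDiff B β := by
  cases k with
  | zero => exact (add_zero _).symm
  | succ k =>
    ext v
    change ceSum B (α + β) v = ceSum B α v + ceSum B β v
    simp only [ceSum, AlternatingMap.add_apply, smul_add, Finset.sum_add_distrib]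

theorem ceDiff_smul {k : ℕ} (B : L [⋀^Fin 2]→ₗ[ℝ] L) (c : ℝ) (α : L [⋀^Fin k]→ₗ[ℝ] N) :
    ceDiff B (c • α) = c • ceDiff B α := by
  cases k with
  | zero => exact (smul_zero _).symm
  | succ k =>
    ext v
    change ceSum B (c • α) v = c • ceSum B α v
    simp only [ceSum, AlternatingMap.smul_apply, Finset.smul_sum]
    exact Finset.sum_congr rfl fun i _ => Finset.sum_congr rfl fun j _ => smul_comm _ _ _

end ChevalleyEilenberg

theorem algD_succ_apply {E : Type*} [NormedAddCommGroup E] [NormedSpace ℝ E]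
    [FiniteDimensional ℝ E] {M : Type*} [TopologicalSpace M] [ChartedSpace E M]
    [IsManifold 𝓘(ℝ, E) ∞ M] {k : ℕ} (η : FormField E M (k + 1)) (V : Fin (k + 2) → VField E M)
    (x : M) : algD η V x = ∑ a : Fin (k + 1), ∑ b ∈ Finset.Ici a,
      (-1 : ℤ) ^ ((a : ℕ) + ((b : ℕ) + 1)) • evalForm η
        (Matrix.vecCons (vfBracket ![V a.castSucc, V b.succ])
          (b.removeNth (a.castSucc.removeNth V))) x := by
  rw [algD, ceDiff_succ_apply, ceSum, Finset.sum_apply]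
  exact Finset.sum_congr rfl fun a _ => Finset.sum_apply _ _ _

theorem sum_vecCons_removeNth {k : ℕ} (i : Fin (k + 2) → ℕ) {a b : Fin (k + 1)} (hab : a ≤ b) :
    ∑ l, Matrix.vecCons (i a.castSucc + i b.succ) (b.removeNth (a.castSucc.removeNth i)) l =
      ∑ l, i l := by
  have h : a.castSucc.succAbove b = b.succ :=
    Fin.succAbove_of_le_castSucc _ _ (Fin.castSucc_le_castSucc_iff.mpr hab)
  rw [Fin.sum_univ_succ, Fin.sum_univ_succAbove i a.castSucc,
    Fin.sum_univ_succAbove (fun j => i (a.castSucc.succAbove j)) b, h, ← add_assoc]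
  rfl

namespace FilteredManifold

variable {E : Type*} [NormedAddCommGroup E] [NormedSpace ℝ E]
  {M : Type*} [TopologicalSpace M] [ChartedSpace E M] [IsManifold 𝓘(ℝ, E) ∞ M]
  (F : FilteredManifold E M)

theorem cochainGE_succ_le (k w : ℕ) :
    F.cochainGE k (w + 1) ≤ F.cochainGE k w :=
  fun _ hc i V hV hi => hc i V hV (by omega)

theorem evalForm_mem {k w : ℕ} {η : FormField E M k} (hη : η ∈ F.formGE k w) :
    evalForm η ∈ F.cochainGE k w :=
  fun i V hV hi => funext fun x => hη.2 x i (fun j => V j x) (fun j => hV j x) hi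

theorem respectsFiltration_evalForm (k : ℕ) :
    RespectsFiltration (evalForm (E := E) (M := M) (k := k)) (F.formGE k) (F.cochainGE k) where
  mem _ _ := F.evalForm_mem
  add _ _ _ _ _ := rfl
  smul _ _ _ _ := rfl

/-! ### The algebraic part in an adapted frame -/

namespace AdaptedFrame

variable {F} {n : ℕ} (P : F.AdaptedFrame n)

theorem basis_apply (x : M) (a : Fin n) : P.basis x a = P.X a x := Module.Basis.mk_apply _ _ a

theorem mem_wt (a : Fin n) (x : M) : P.X a x ∈ F.H (P.wt a) x := by
  rw [← P.span_eq]
  exact Submodule.subset_span ⟨a, by simp, rfl⟩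

theorem bracket_apply (x : M) (a b : Fin n) :
    P.bracket x ![P.X a x, P.X b x] = VectorField.mlieBracket 𝓘(ℝ, E) (P.X a) (P.X b) x := by
  change ∑ c, ∑ d, ((P.basis x).coord c (P.X a x) * (P.basis x).coord d (P.X b x)) •
    VectorField.mlieBracket 𝓘(ℝ, E) (P.X c) (P.X d) x = _
  rw [← P.basis_apply, ← P.basis_apply]
  simp [Finsupp.single_apply]

theorem algD_add {k : ℕ} (η θ : FormField E M k) : P.algD (η + θ) = P.algD η + P.algD θ :=
  funext fun x => ContinuousAlternatingMap.ext fun v => DFunLike.congr_fun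
    (ceDiff_add (P.bracket x) (η x).toAlternatingMap (θ x).toAlternatingMap) v

theorem algD_smul {k : ℕ} (c : ℝ) (η : FormField E M k) : P.algD (c • η) = c • P.algD η :=
  funext fun x => ContinuousAlternatingMap.ext fun v => DFunLike.congr_fun
    (ceDiff_smul (P.bracket x) c (η x).toAlternatingMap) v

end AdaptedFrame

variable [FiniteDimensional ℝ E]

theorem bracket_mem_vecCons {k : ℕ} {i : Fin (k + 2) → ℕ} {V : Fin (k + 2) → VField E M}
    (hV : ∀ j x, V j x ∈ F.H (i j) x) (a b : Fin (k + 1)) (l : Fin (k + 1)) (x : M) :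
    (Matrix.vecCons (vfBracket ![V a.castSucc, V b.succ])
      (b.removeNth (a.castSucc.removeNth V)) l : VField E M) x ∈
      F.H (Matrix.vecCons (i a.castSucc + i b.succ)
        (b.removeNth (a.castSucc.removeNth i)) l : ℕ) x := by
  refine Fin.cases ?_ (fun l => ?_) l
  · exact F.bracket_mem _ _ _ _ (hV _) (hV _) x
  · exact hV _ x

theorem algD_mem {k w : ℕ} {η : FormField E M k} (hη : η ∈ F.formGE k w) :
    algD η ∈ F.cochainGE (k + 1) w := by
  cases k with
  | zero => exact Submodule.zero_mem _
  | succ k =>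
    intro i V hV hi
    change ceSum vfBracket (evalForm η) V = 0
    refine Finset.sum_eq_zero fun a _ => Finset.sum_eq_zero fun b hb => ?_
    rw [F.evalForm_mem hη _ _ (F.bracket_mem_vecCons hV a b)
      (by rwa [sum_vecCons_removeNth i (Finset.mem_Ici.mp hb)]), smul_zero]

theorem respectsFiltration_algD (k : ℕ) :
    RespectsFiltration (algD (E := E) (M := M) (k := k)) (F.formGE k) (F.cochainGE (k + 1)) where
  mem _ _ := F.algD_mem
  add _ η _ θ _ := ceDiff_add vfBracket (evalForm η) (evalForm θ)
  smul _ c η _ := ceDiff_smul vfBracket c (evalForm η)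

/-- The exterior derivative and its algebraic part differ by terms of higher weight. -/
theorem evalForm_extD_sub_algD_mem {k w : ℕ} {η : FormField E M k} (hη : η ∈ F.formGE k w) :
    evalForm (extD η) - algD η ∈ F.cochainGE (k + 1) (w + 1) := by
  intro i V hV hi
  funext x
  change evalForm (extD η) V x - algD η V x = 0
  rw [hη.1.evalForm_extD V x, add_sub_cancel_right]
  refine Finset.sum_eq_zero fun a _ => ?_
  rw [Fin.sum_univ_succAbove i a] at hi
  rcases Nat.eq_zero_or_pos (i a) with h0 | h0
  · have h : V a x = 0 := by
      have := hV a x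
      rwa [h0, F.H_zero, Submodule.mem_bot] at this
    rw [h, map_zero, smul_zero]
  · have h : evalForm η (a.removeNth V) = 0 :=
      F.evalForm_mem hη (a.removeNth i) _ (fun j x => hV _ x)
        (by change ∑ j, i (a.succAbove j) < w; omega)
    have h' : mvfderiv 𝓘(ℝ, E) (fun _ : M => (0 : ℝ)) x = 0 := mvfderiv_const ..
    rw [h]
    exact (congrArg (fun T => (-1 : ℤ) ^ (a : ℕ) • T (V a x)) h').trans (smul_zero _)

theorem IsOscBracket.vecCons {x : M} {B : F.Gr x [⋀^Fin 2]→ₗ[ℝ] F.Gr x} (hB : F.IsOscBracket x B)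
    {k : ℕ} {i : Fin (k + 2) → ℕ} {V : Fin (k + 2) → VField E M}
    (hV : ∀ j x, V j x ∈ F.H (i j) x) (a b : Fin (k + 1)) :
    Matrix.vecCons (B ![F.cls (i a.castSucc) (V a.castSucc x) (hV _ x),
        F.cls (i b.succ) (V b.succ x) (hV _ x)])
      (b.removeNth (a.castSucc.removeNth fun j => F.cls (i j) (V j x) (hV j x))) =
    fun l => F.cls _ _ (F.bracket_mem_vecCons hV a b l x) := by
  funext l
  refine Fin.cases ?_ (fun l => ?_) l
  · exact hB _ _ _ _ (hV _) (hV _)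
  · rfl

namespace AdaptedFrame

variable {F} {n : ℕ} (P : F.AdaptedFrame n)

theorem algD_apply {k : ℕ} (η : FormField E M k) (x : M) (r : Fin (k + 1) → Fin n) :
    P.algD η x (fun j => P.X (r j) x) = _root_.algD η (fun j => P.X (r j)) x := by
  cases k with
  | zero => rfl
  | succ k =>
    refine (ceDiff_succ_apply (P.bracket x) (η x).toAlternatingMap
      (fun j => P.X (r j) x)).trans (Eq.trans ?_ (algD_succ_apply η _ x).symm)
    refine Finset.sum_congr rfl fun a _ => Finset.sum_congr rfl fun b _ =>
      congrArg _ (congrArg (η x) (funext fun l => ?_))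
    refine Fin.cases ?_ (fun l => ?_) l
    · exact P.bracket_apply x _ _
    · rfl

theorem isSmoothForm_algD {k : ℕ} {η : FormField E M k} (hη : IsSmoothForm η) :
    IsSmoothForm (P.algD η) := fun x =>
  contMDiffAt_form_of_frame (X := fun a => P.X a) (fun a => (P.X a).contMDiff x) (P.basis x)
    (P.basis_apply x) fun r =>
      ((hη.contMDiff_algD fun j => P.X (r j)) x).congr_of_eventuallyEq
        (.of_forall fun y => P.algD_apply η y r)

end AdaptedFrame

variable [T2Space M]

theorem oscD_symbol_cls {k w : ℕ} (η : F.formGE k w) (i : Fin (k + 1) → ℕ)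
    (V : Fin (k + 1) → VField E M) (hV : ∀ j x, V j x ∈ F.H (i j) x) (x : M) :
    F.oscD (F.symbol k w η : F.OscField k) x (fun j => F.cls (i j) (V j x) (hV j x)) =
      if ∑ j, i j = w then algD (η : FormField E M k) V x else 0 := by
  cases k with
  | zero => exact (ite_self _).symm
  | succ k =>
    have key : ∀ a b : Fin (k + 1), a ≤ b →
        (F.symbol (k + 1) w η : F.OscField (k + 1)) x
          (Matrix.vecCons (F.oscBracket x ![F.cls (i a.castSucc) (V a.castSucc x) (hV _ x),
              F.cls (i b.succ) (V b.succ x) (hV _ x)])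
            (b.removeNth (a.castSucc.removeNth fun j => F.cls (i j) (V j x) (hV j x)))) =
        if ∑ j, i j = w then evalForm (η : FormField E M (k + 1))
          (Matrix.vecCons (vfBracket ![V a.castSucc, V b.succ])
            (b.removeNth (a.castSucc.removeNth V))) x else 0 := by
      intro a b hab
      rw [(F.isOscBracket_oscBracket x).vecCons F hV a b, ← sum_vecCons_removeNth i hab]
      exact F.symbol_cls η _ _ (fun l => F.bracket_mem_vecCons hV a b l x)
    refine (ceDiff_succ_apply (F.oscBracket x) ((F.symbol (k + 1) w η : F.OscField (k + 1)) x)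
      (fun j => F.cls (i j) (V j x) (hV j x))).trans ?_
    rw [algD_succ_apply]
    split_ifs with h
    · refine Finset.sum_congr rfl fun a _ => Finset.sum_congr rfl fun b hb => ?_
      rw [key a b (Finset.mem_Ici.mp hb), if_pos h]
    · refine Finset.sum_eq_zero fun a _ => Finset.sum_eq_zero fun b hb => ?_
      rw [key a b (Finset.mem_Ici.mp hb), if_neg h, smul_zero]

theorem mem_formGE_of_evalForm_mem {k w : ℕ} {θ : FormField E M k} (hθ : IsSmoothForm θ)
    (h : evalForm θ ∈ F.cochainGE k w) : θ ∈ F.formGE k w := by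
  refine ⟨hθ, fun x i v hv hi => ?_⟩
  choose V hV hVx using fun j => F.exists_section (hv j)
  obtain rfl : (fun j => V j x) = v := funext hVx
  exact congrFun (h i V hV hi) x

theorem extD_mem {k w : ℕ} {η : FormField E M k} (hη : η ∈ F.formGE k w) :
    extD η ∈ F.formGE (k + 1) w := by
  refine F.mem_formGE_of_evalForm_mem hη.1.extD ?_
  rw [← sub_add_cancel (evalForm (extD η)) (algD η)]
  exact Submodule.add_mem _ (F.cochainGE_succ_le _ _ (F.evalForm_extD_sub_algD_mem hη))
    (F.algD_mem hη)

theorem symbol_extD {k w : ℕ} (η : F.formGE k w) :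
    (F.symbol (k + 1) w ⟨extD η, F.extD_mem η.2⟩ : F.OscField (k + 1)) =
      F.oscD (F.symbol k w η : F.OscField k) := by
  funext x
  refine F.alternatingMap_ext_cls fun i v hv => ?_
  choose V hV hVx using fun j => F.exists_section (hv j)
  obtain rfl : (fun j => V j x) = v := funext hVx
  refine (F.symbol_cls _ i _ hv).trans ((F.oscD_symbol_cls η i V hV x).trans ?_).symm
  split_ifs with h
  · exact (sub_eq_zero.mp (congrFun
      (F.evalForm_extD_sub_algD_mem η.2 i V hV (by omega)) x)).symm
  · rfl

theorem respectsFiltration_extD (k : ℕ) :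
    RespectsFiltration (extD (E := E) (M := M) (k := k)) (F.formGE k) (F.formGE (k + 1)) where
  mem _ _ := F.extD_mem
  add _ _ hη _ hθ := hη.1.extD_add hθ.1
  smul _ c η _ := extD_smul c η

namespace AdaptedFrame

variable {F} {n : ℕ} (P : F.AdaptedFrame n)

theorem extD_sub_algD_mem {k w : ℕ} {η : FormField E M k} (hη : η ∈ F.formGE k w) :
    extD η - P.algD η ∈ F.formGE (k + 1) (w + 1) := by
  refine ⟨hη.1.extD.sub_section (P.isSmoothForm_algD hη.1), fun x i v hv hi => ?_⟩
  refine ((extD η x).toAlternatingMap.toMultilinearMap -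
    (P.algD η x).toAlternatingMap.toMultilinearMap).eq_zero_of_mem_span
    (fun j => (fun a => P.X a x) '' {a | P.wt a ≤ i j}) (fun v hv => ?_) v
    (fun j => by rw [P.span_eq]; exact hv j)
  choose r hr hv using hv
  obtain rfl : (fun j => P.X (r j) x) = v := funext hv
  refine (congrArg (extD η x (fun j => P.X (r j) x) - ·) (P.algD_apply η x r)).trans ?_
  exact congrFun (F.evalForm_extD_sub_algD_mem hη (fun j => P.wt (r j)) (fun j => P.X (r j))
    (fun j => P.mem_wt _) ((Finset.sum_le_sum fun j _ => hr j).trans_lt hi)) x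

theorem algD_mem {k w : ℕ} {η : FormField E M k} (hη : η ∈ F.formGE k w) :
    P.algD η ∈ F.formGE (k + 1) w := by
  rw [← sub_sub_cancel (extD η) (P.algD η)]
  refine Submodule.sub_mem _ (F.extD_mem hη) ?_
  have h := P.extD_sub_algD_mem hη
  exact ⟨h.1, fun x i v hv hi => h.2 x i v hv (by omega)⟩

theorem respectsFiltration_algD (k : ℕ) :
    RespectsFiltration (P.algD (k := k)) (F.formGE k) (F.formGE (k + 1)) where
  mem _ _ := P.algD_mem
  add _ η _ θ _ := P.algD_add η θ
  smul _ c η _ := P.algD_smul c η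

end AdaptedFrame

end FilteredManifold

section Graded

variable {A B C : Type*} [AddCommGroup A] [Module ℝ A] [AddCommGroup B] [Module ℝ B]
  [AddCommGroup C] [Module ℝ C] {FA : ℕ → Submodule ℝ A} {FB : ℕ → Submodule ℝ B}
  {FC : ℕ → Submodule ℝ C}

theorem grMap_mk {T : A → B} (h : RespectsFiltration T FA FB) {w : ℕ} (a : FA w) :
    grMap h w (Submodule.Quotient.mk a) = Submodule.Quotient.mk ⟨T a, h.mem w a a.2⟩ := rfl

theorem grMap_injective {T : A → B} (h : RespectsFiltration T FA FB) {w : ℕ}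
    (hT : ∀ a ∈ FA w, T a ∈ FB (w + 1) → a ∈ FA (w + 1)) : Function.Injective (grMap h w) := by
  rw [injective_iff_map_eq_zero]
  intro q hq
  obtain ⟨a, rfl⟩ := Submodule.Quotient.mk_surjective _ q
  rw [grMap_mk, Submodule.Quotient.mk_eq_zero] at hq
  exact (Submodule.Quotient.mk_eq_zero _).mpr (hT a a.2 hq)

theorem grMap_eq_of_sub_mem {T T' : A → B} (h : RespectsFiltration T FA FB)
    (h' : RespectsFiltration T' FA FB) {w : ℕ} (hT : ∀ a ∈ FA w, T a - T' a ∈ FB (w + 1))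
    (q : GrPiece FA w) : grMap h w q = grMap h' w q := by
  obtain ⟨a, rfl⟩ := Submodule.Quotient.mk_surjective _ q
  rw [grMap_mk, grMap_mk]
  exact (Submodule.Quotient.eq _).mpr (hT a a.2)

theorem grMap_comp_eq_of_sub_mem {T : A → B} {S : B → C} {R : A → C}
    (hT : RespectsFiltration T FA FB) (hS : RespectsFiltration S FB FC)
    (hR : RespectsFiltration R FA FC) {w : ℕ} (h : ∀ a ∈ FA w, S (T a) - R a ∈ FC (w + 1))
    (q : GrPiece FA w) : grMap hR w q = grMap hS w (grMap hT w q) := by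
  obtain ⟨a, rfl⟩ := Submodule.Quotient.mk_surjective _ q
  rw [grMap_mk, grMap_mk, grMap_mk, eq_comm]
  exact (Submodule.Quotient.eq _).mpr (h a a.2)

end Graded

theorem FilteredManifold.symbolEquiv_grMap_extD {E : Type*} [NormedAddCommGroup E]
    [NormedSpace ℝ E] [FiniteDimensional ℝ E] {M : Type*} [TopologicalSpace M] [ChartedSpace E M]
    [IsManifold 𝓘(ℝ, E) ∞ M] [T2Space M] [SigmaCompactSpace M] (F : FilteredManifold E M) {k w : ℕ}
    (q : GrPiece (F.formGE k) w) :
    (F.symbolEquiv (k + 1) w (grMap (F.respectsFiltration_extD k) w q) : F.OscField (k + 1)) =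
      F.oscD (F.symbolEquiv k w q : F.OscField k) := by
  obtain ⟨η, rfl⟩ := Submodule.Quotient.mk_surjective _ q
  rw [grMap_mk, F.symbolEquiv_mk, F.symbolEquiv_mk]
  exact F.symbol_extD η

end

theorem mainTheorem2 {E : Type*} [NormedAddCommGroup E] [NormedSpace ℝ E] [FiniteDimensional ℝ E]
    {M : Type*} [TopologicalSpace M] [ChartedSpace E M] [IsManifold 𝓘(ℝ, E) ∞ M]
    [T2Space M] [SigmaCompactSpace M] (F : FilteredManifold E M) :
    -- the osculating bracket is well defined
    (∀ x, F.IsOscBracket x (F.oscBracket x)) ∧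
    -- `Φ` is the canonical identification `gr (Ω^k(M)) ≅ Γ(⋀ᵏ gr(T*M))`, weight by weight
    ∃ Φ : ∀ k w : ℕ, GrPiece (F.formGE k) w ≃ₗ[ℝ] F.oscForm k w,
      F.IsCanonical Φ ∧
      (∀ k : ℕ,
        ∃ (hd : RespectsFiltration (extD (E := E) (M := M) (k := k))
            (F.formGE k) (F.formGE (k + 1)))
          (ha : RespectsFiltration (algD (E := E) (M := M) (k := k))
            (F.formGE k) (F.cochainGE (k + 1)))
          (he : RespectsFiltration (evalForm (E := E) (M := M) (k := k + 1))
            (F.formGE (k + 1)) (F.cochainGE (k + 1))),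
          -- the difference strictly raises the weight
          (∀ w : ℕ, ∀ η ∈ F.formGE k w,
            evalForm (extD η) - algD η ∈ F.cochainGE (k + 1) (w + 1)) ∧
          -- `gr (Ω^(k+1)(M))` embeds into the graded space of cochains, where
          -- the maps induced by `extD` and `algD` agree
          (∀ w, Function.Injective (grMap he w)) ∧
          (∀ w (q : GrPiece (F.formGE k) w), grMap ha w q = grMap he w (grMap hd w q)) ∧
          -- and they are the osculating Chevalley-Eilenberg differential
          (∀ w (q : GrPiece (F.formGE k) w),
            (Φ (k + 1) w (grMap hd w q) : F.OscField (k + 1)) =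
              F.oscD (Φ k w q : F.OscField k))) ∧
      -- the same for the algebraic part computed in an adapted frame
      (∀ (n : ℕ) (P : F.AdaptedFrame n) (k : ℕ),
        ∃ hP : RespectsFiltration (P.algD (k := k)) (F.formGE k) (F.formGE (k + 1)),
          (∀ w : ℕ, ∀ η ∈ F.formGE k w, extD η - P.algD η ∈ F.formGE (k + 1) (w + 1)) ∧
          (∀ w (q : GrPiece (F.formGE k) w),
            (Φ (k + 1) w (grMap hP w q) : F.OscField (k + 1)) =
              F.oscD (Φ k w q : F.OscField k))) := by
  refine ⟨F.isOscBracket_oscBracket, F.symbolEquiv, F.isCanonical_symbolEquiv, fun k =>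
    ⟨F.respectsFiltration_extD k, F.respectsFiltration_algD k,
      F.respectsFiltration_evalForm (k + 1), fun w η => F.evalForm_extD_sub_algD_mem, fun w => ?_,
      fun w => grMap_comp_eq_of_sub_mem _ _ _ fun η => F.evalForm_extD_sub_algD_mem,
      fun w => F.symbolEquiv_grMap_extD⟩, fun n P k =>
    ⟨P.respectsFiltration_algD k, fun w η => P.extD_sub_algD_mem, fun w q => ?_⟩⟩
  · exact grMap_injective _ fun η hη => F.mem_formGE_of_evalForm_mem hη.1
  · rw [← grMap_eq_of_sub_mem (F.respectsFiltration_extD k) (P.respectsFiltration_algD k)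
      (fun η => P.extD_sub_algD_mem) q]
    exact F.symbolEquiv_grMap_extD q
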